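/- Let $G$ be a finite forest (a finite simple graph without cycles) with $n=|V(G)|$ vertices, and let $r\ge 1$ be an integer with $r\ge n-5$. A set $A\subseteq V(G)$ is called $r$-independent if every connected component of the induced subgraph $G[A]$ has at most $r$ vertices, and $\operatorname{Ind}_r(G)$ denotes the simplicial complex on $V(G)$ whose faces are the $r$-independent subsets of $V(G)$ (including $\emptyset$). Then $\operatorname{Ind}_r(G)$ is shellable (in the not necessarily pure sense): its facets can be ordered $F_1,\dots,F_t$ without repetition so that, for every $1<k\le t$, the complex $\langle F_k\rangle\cap\langle F_1,\dots,F_{k-1}\rangle$ is pure of dimension $\dim F_k-1$. Here $\langle\mathcal F\rangle$ is the complex of all subsets of members of $\mathcal F$, $\dim F=|F|-1$, and a complex is pure of dimension $d$ if all of its facets have dimension $d$. -/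

import Mathlib

/-- A set `A` of vertices of `G` is `r`-independent if every connected component of the induced
subgraph `G[A]` has at most `r` vertices. -/
def IsRIndependent {V : Type*} (G : SimpleGraph V) (r : ℕ) (A : Finset V) : Prop :=
  ∀ c : (G.induce (A : Set V)).ConnectedComponent, c.supp.ncard ≤ r

theorem IsRIndependent.mono {V : Type*} {G : SimpleGraph V} {r : ℕ} {A B : Finset V}
    (hBA : B ⊆ A) (hA : IsRIndependent G r A) : IsRIndependent G r B := by
  intro c
  have hs : (B : Set V) ⊆ (A : Set V) := by exact_mod_cast hBA
  let f := SimpleGraph.induceHomOfLE G hs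
  refine le_trans ?_ (hA (c.map f.toHom))
  refine Set.ncard_le_ncard_of_injOn f ?_ f.injective.injOn (Set.toFinite _)
  intro v hv
  rw [SimpleGraph.ConnectedComponent.mem_supp_iff] at hv ⊢
  subst hv
  rfl

/-- The `r`-independence complex of `G`: the simplicial complex whose faces are the
`r`-independent vertex sets. Here and below a simplicial complex with vertices in `V` is a
collection of finite subsets of `V` (its faces, with the empty set allowed as a face) that is
closed under taking subsets, that is, a term of `LowerSet (Finset V)`. -/
def rIndependenceComplex {V : Type*} (G : SimpleGraph V) (r : ℕ) : LowerSet (Finset V) where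
  carrier := {A | IsRIndependent G r A}
  lower' := fun _ _ hBA hA => IsRIndependent.mono hBA hA

/-- For `r ≥ 1` every vertex of `G` is a vertex of the `r`-independence complex. -/
theorem singleton_mem_rIndependenceComplex {V : Type*} (G : SimpleGraph V) {r : ℕ} (hr : 1 ≤ r)
    (v : V) : ({v} : Finset V) ∈ rIndependenceComplex G r := by
  intro c
  refine le_trans (Set.ncard_le_card c.supp) ?_
  simpa using hr

/-- The facets of a simplicial complex: its inclusion-maximal faces. -/
def IsFacet {V : Type*} (Δ : LowerSet (Finset V)) (F : Finset V) : Prop :=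
  Maximal (fun A => A ∈ Δ) F

/-- The dimension `|F| - 1` of a face; the empty face has dimension `-1`. -/
def faceDim {V : Type*} (F : Finset V) : ℤ := (F.card : ℤ) - 1

/-- The simplicial complex `Δ` is pure and `d`-dimensional: it has a face, and all its facets have
dimension `d`. -/
def IsPureOfDim {V : Type*} (Δ : LowerSet (Finset V)) (d : ℤ) : Prop :=
  (∃ F, F ∈ Δ) ∧ ∀ F, IsFacet Δ F → faceDim F = d

/-- The simplicial complex `⟨𝓕⟩` generated by a family of finite sets: all subsets of members. -/
def generatedComplex {V : Type*} (𝓕 : Set (Finset V)) : LowerSet (Finset V) :=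
  lowerClosure 𝓕

/-- (Not necessarily pure) shellability of a complex: its facets can be listed without repetition
as `F 0, …, F (t - 1)` such that, for every `k` except the first, the complex
`⟨F k⟩ ∩ ⟨F 0, …, F (k - 1)⟩` is pure of dimension `dim (F k) - 1`. -/
def IsShellable {V : Type*} (Δ : LowerSet (Finset V)) : Prop :=
  ∃ (t : ℕ) (F : Fin t → Finset V),
    Function.Injective F ∧ Set.range F = {A | IsFacet Δ A} ∧
      ∀ k : Fin t, 0 < (k : ℕ) →
        IsPureOfDim (generatedComplex {F k} ⊓ generatedComplex (F '' {j | j < k}))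
          (faceDim (F k) - 1)

/-! The engine is vertex shedding: if deletion and link of `v` are shellable and every facet of the
deletion is a facet of the complex, the shelling of the deletion followed by that of the link shells
the whole (`HasShelling.of_shedding`).

For r = 1, 2 the faces are the vertex sets inducing maximum degree 0 or 1;
`hasShelling_sparseComplex` shells such complexes for forests. Let r ≥ 3. Two disjoint connected
sets with more than r vertices would give 2r + 2 ≤ n ≤ r + 5, so r = 3, n = 8 and the two sets are
complementary of size 4; shedding the ends of the edge joining them, if there is one, settles this
case. Otherwise the large connected sets meet pairwise, and by the Helly property of subtrees they
share a vertex x. The deletion of x is then a simplex, and its link records only the size of the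
component of x.

That size is handled by rooting the tree at x: a missing vertex v cuts off the set D v of its
descendants, these sets form a laminar family, and the condition says that the missing vertices cut
off enough. `hasShelling_laminarComplex` shells this by shedding a vertex with the largest D v.

The sparse case and the Helly property both rest on `exists_penultimate`: walking through a forest
from nonface to smaller nonface branch ends at a vertex x that turns a face, made of whole branches
at x, into a nonface. -/

/-- A shelling of `Δ`, encoded by a ranking of its facets. -/
def HasShelling {V : Type*} [DecidableEq V] (Δ : LowerSet (Finset V)) : Prop :=
  ∃ f : Finset V → ℕ, Set.InjOn f {F | IsFacet Δ F} ∧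
    ∀ E F, IsFacet Δ E → IsFacet Δ F → f E < f F →
      ∃ D, IsFacet Δ D ∧ f D < f F ∧ ∃ x ∈ F, x ∉ E ∧ F.erase x ⊆ D

/-! ### Shellings and shedding vertices. -/

section Shelling

variable {V : Type*}

theorem exists_isFacet_superset [Fintype V] {Δ : LowerSet (Finset V)} {A : Finset V} (hA : A ∈ Δ) :
    ∃ F, A ⊆ F ∧ IsFacet Δ F :=
  Finite.exists_le_maximal (p := fun B => B ∈ Δ) hA

theorem IsFacet.eq_of_subset {Δ : LowerSet (Finset V)} {F A : Finset V} (hF : IsFacet Δ F)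
    (hA : A ∈ Δ) (h : F ⊆ A) : F = A :=
  le_antisymm h (hF.2 hA h)

variable [DecidableEq V]

theorem IsFacet.insert_notMem {Δ : LowerSet (Finset V)} {F : Finset V} (hF : IsFacet Δ F)
    {x : V} (hx : x ∉ F) : insert x F ∉ Δ := fun h =>
  hx (hF.2 h (Finset.subset_insert x F) (Finset.mem_insert_self x F))

/-- A complex with at most one facet is shellable. -/
theorem HasShelling.of_subsingleton {Δ : LowerSet (Finset V)}
    (h : ∀ E F, IsFacet Δ E → IsFacet Δ F → E = F) : HasShelling Δ :=
  ⟨fun _ => 0, fun _ hE _ hF _ => h _ _ hE hF, fun _ _ _ _ hlt => absurd hlt (lt_irrefl _)⟩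

theorem HasShelling.of_forall_notMem {Δ : LowerSet (Finset V)} (h : ∀ A, A ∉ Δ) :
    HasShelling Δ :=
  .of_subsingleton fun E _ hE _ => absurd hE.1 (h E)

theorem HasShelling.simplex {Δ : LowerSet (Finset V)} {Q : Finset V}
    (h : ∀ A, A ∈ Δ ↔ A ⊆ Q) : HasShelling Δ :=
  .of_subsingleton fun E F hE hF => by
    have hQ : Q ∈ Δ := (h Q).2 subset_rfl
    rw [hE.eq_of_subset hQ ((h E).1 hE.1), hF.eq_of_subset hQ ((h F).1 hF.1)]

/-- If `v` is a shedding vertex of `Δ` and both the deletion and the link of `v` are shellable,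
then `Δ` is shellable. -/
theorem HasShelling.of_shedding [Fintype V] {Δ Δd Δl : LowerSet (Finset V)} (v : V)
    (hd : ∀ A, A ∈ Δd ↔ v ∉ A ∧ A ∈ Δ) (hl : ∀ A, A ∈ Δl ↔ v ∉ A ∧ insert v A ∈ Δ)
    (hshed : ∀ A, v ∉ A → insert v A ∈ Δ → ∃ x, x ∉ A ∧ x ≠ v ∧ insert x A ∈ Δ)
    (sd : HasShelling Δd) (sl : HasShelling Δl) : HasShelling Δ := by
  obtain ⟨fd, injd, shd⟩ := sd
  obtain ⟨fl, injl, shl⟩ := sl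
  have facet_d : ∀ F, v ∉ F → (IsFacet Δ F ↔ IsFacet Δd F) := by
    intro F hv
    constructor
    · intro hF
      exact ⟨(hd F).2 ⟨hv, hF.1⟩, fun A hA hFA => hF.2 ((hd A).1 hA).2 hFA⟩
    · intro hF
      refine ⟨((hd F).1 hF.1).2, fun A hA hFA => ?_⟩
      by_cases hvA : v ∈ A
      · have hins : insert v F ∈ Δ :=
          Δ.lower (Finset.insert_subset hvA hFA : insert v F ≤ A) hA
        -- Shedding enters only here: a facet of the deletion cannot be extended by `v`.
        obtain ⟨x, hxF, hxv, hx⟩ := hshed F hv hins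
        refine absurd ((hd _).2 ⟨?_, hx⟩) (hF.insert_notMem hxF)
        simp [hxv.symm, hv]
      · exact hF.2 ((hd A).2 ⟨hvA, hA⟩) hFA
  have facet_l : ∀ F, v ∈ F → (IsFacet Δ F ↔ IsFacet Δl (F.erase v)) := by
    intro F hv
    constructor
    · intro hF
      refine ⟨(hl _).2 ⟨Finset.notMem_erase v F, by rw [Finset.insert_erase hv]; exact hF.1⟩, ?_⟩
      intro A hA hFA
      obtain ⟨hvA, hA'⟩ := (hl A).1 hA
      have h1 : F ⊆ insert v A := by
        rw [← Finset.insert_erase hv]; exact Finset.insert_subset_insert v hFA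
      have h2 := hF.eq_of_subset hA' h1
      rw [h2, Finset.erase_insert hvA]
    · intro hF
      have h1 := ((hl _).1 hF.1).2
      rw [Finset.insert_erase hv] at h1
      refine ⟨h1, fun A hA hFA => ?_⟩
      have hvA : v ∈ A := hFA hv
      have h2 : A.erase v ∈ Δl :=
        (hl _).2 ⟨Finset.notMem_erase v A, by rw [Finset.insert_erase hvA]; exact hA⟩
      have h3 := hF.eq_of_subset h2 (Finset.erase_subset_erase v hFA)
      have h4 : F = A := by rw [← Finset.insert_erase hv, h3, Finset.insert_erase hvA]
      exact h4.ge
  -- The offset exceeds every rank in the deletion, so all facets avoiding `v` precede those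
  -- containing it.
  set N := (Finset.univ.sup fd) + 1 with hN
  have hlt : ∀ F, fd F < N := fun F =>
    Nat.lt_succ_of_le (Finset.le_sup (f := fd) (Finset.mem_univ F))
  refine ⟨fun F => if v ∈ F then N + fl (F.erase v) else fd F, ?_, ?_⟩
  · intro E hE F hF h
    change IsFacet Δ E at hE
    change IsFacet Δ F at hF
    by_cases hvE : v ∈ E <;> by_cases hvF : v ∈ F <;> simp only [hvE, hvF, if_true, if_false] at h
    · have h1 := injl ((facet_l E hvE).1 hE) ((facet_l F hvF).1 hF) (by omega)
      rw [← Finset.insert_erase hvE, h1, Finset.insert_erase hvF]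
    · have := hlt F; omega
    · have := hlt E; omega
    · exact injd ((facet_d E hvE).1 hE) ((facet_d F hvF).1 hF) h
  · intro E F hE hF h
    by_cases hvF : v ∈ F
    · by_cases hvE : v ∈ E
      · simp only [hvE, hvF, if_true, add_lt_add_iff_left] at h
        obtain ⟨D, hD, hDF, x, hxF, hxE, hxD⟩ :=
          shl _ _ ((facet_l E hvE).1 hE) ((facet_l F hvF).1 hF) h
        have hvD := ((hl D).1 hD.1).1
        obtain ⟨hxv, hxF'⟩ := Finset.mem_erase.1 hxF
        have hD' : IsFacet Δ (insert v D) := by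
          rw [facet_l _ (Finset.mem_insert_self v D), Finset.erase_insert hvD]; exact hD
        refine ⟨insert v D, hD', ?_, x, hxF', ?_, ?_⟩
        · simp [hvF, Finset.erase_insert hvD, hDF]
        · exact fun hx => hxE (Finset.mem_erase.2 ⟨hxv, hx⟩)
        · intro y hy
          obtain ⟨hyx, hyF⟩ := Finset.mem_erase.1 hy
          by_cases hyv : y = v
          · simp [hyv]
          · exact Finset.mem_insert_of_mem
              (hxD (Finset.mem_erase.2 ⟨hyx, Finset.mem_erase.2 ⟨hyv, hyF⟩⟩))
      -- Only `F` contains `v`, so `v` is the exchanged vertex and any facet of the deletion above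
      -- `F.erase v` serves.
      · have h1 : F.erase v ∈ Δd :=
          (hd _).2 ⟨Finset.notMem_erase v F, Δ.lower (Finset.erase_subset v F) hF.1⟩
        obtain ⟨D, hFD, hD⟩ := exists_isFacet_superset h1
        have hvD := ((hd D).1 hD.1).1
        refine ⟨D, (facet_d D hvD).2 hD, ?_, v, hvF, hvE, hFD⟩
        simp only [hvD, hvF, if_true, if_false]
        have := hlt D; omega
    · by_cases hvE : v ∈ E
      · simp only [hvE, hvF, if_true, if_false] at h
        have := hlt F; omega
      · simp only [hvE, hvF, if_false] at h
        obtain ⟨D, hD, hDF, x, hxF, hxE, hxD⟩ :=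
          shd _ _ ((facet_d E hvE).1 hE) ((facet_d F hvF).1 hF) h
        have hvD := ((hd D).1 hD.1).1
        refine ⟨D, (facet_d D hvD).2 hD, ?_, x, hxF, hxE, hxD⟩
        simp only [hvD, hvF, if_false, hDF]

/-- A common face of `F k` and an earlier `F j` lies in some `(F k).erase x` that is itself in the
intersection, so the facets of the intersection have codimension one in `F k`. -/
theorem HasShelling.isShellable [Fintype V] {Δ : LowerSet (Finset V)} (h : HasShelling Δ) :
    IsShellable Δ := by
  classical
  obtain ⟨f, inj, hf⟩ := h
  set S : Finset (Finset V) := {F | IsFacet Δ F} with hS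
  have memS : ∀ F, F ∈ S ↔ IsFacet Δ F := fun F => by simp [hS]
  set T : Finset ℕ := S.image f with hT
  have hex : ∀ k : Fin T.card, ∃ F, IsFacet Δ F ∧ f F = T.orderEmbOfFin rfl k := by
    intro k
    obtain ⟨F, hF, hk⟩ := Finset.mem_image.1 (T.orderEmbOfFin_mem rfl k)
    exact ⟨F, (memS F).1 hF, hk⟩
  choose F hF hfF using hex
  have hsurj : ∀ E, IsFacet Δ E → ∃ k, F k = E := by
    intro E hE
    have : f E ∈ Set.range (T.orderEmbOfFin rfl) := by
      rw [Finset.range_orderEmbOfFin]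
      exact Finset.mem_coe.2 (Finset.mem_image_of_mem f ((memS E).2 hE))
    obtain ⟨k, hk⟩ := this
    exact ⟨k, inj (hF k) hE (by rw [hfF, hk])⟩
  have hlt : ∀ j k, f (F j) < f (F k) ↔ j < k := by
    intro j k
    rw [hfF, hfF, OrderEmbedding.lt_iff_lt]
  refine ⟨T.card, F, ?_, ?_, ?_⟩
  · intro j k hjk
    exact (T.orderEmbOfFin rfl).injective (by rw [← hfF, ← hfF, hjk])
  · ext E
    exact ⟨fun ⟨k, hk⟩ => hk ▸ hF k, hsurj E⟩
  · intro k hk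
    have hmem : ∀ A, A ∈ generatedComplex {F k} ⊓ generatedComplex (F '' {j | j < k}) ↔
        A ⊆ F k ∧ ∃ j, j < k ∧ A ⊆ F j := by
      intro A
      simp [generatedComplex, LowerSet.mem_inf_iff, mem_lowerClosure]
    constructor
    · refine ⟨∅, (hmem _).2 ⟨Finset.empty_subset _, ⟨0, k.pos⟩, ?_, Finset.empty_subset _⟩⟩
      exact Fin.lt_def.2 hk
    · intro A hA
      obtain ⟨hAk, j, hj, hAj⟩ := (hmem A).1 hA.1
      obtain ⟨D, hD, hDk, x, hxk, hxj, hxD⟩ := hf _ _ (hF j) (hF k) ((hlt j k).2 hj)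
      obtain ⟨l, rfl⟩ := hsurj D hD
      have hAx : A ⊆ (F k).erase x := fun y hy =>
        Finset.mem_erase.2 ⟨fun h => hxj (h ▸ hAj hy), hAk hy⟩
      have := hA.eq_of_subset ((hmem _).2 ⟨Finset.erase_subset _ _, l, (hlt l k).1 hDk, hxD⟩) hAx
      rw [this, faceDim, faceDim, Finset.card_erase_of_mem hxk]
      have : 0 < (F k).card := Finset.card_pos.2 ⟨x, hxk⟩
      omega

/-! ### Complexes defined by covering with a laminar family. -/

/-- The faces of `laminarComplex D P C m` are the subsets of `P ∪ C` missing enough elements of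
`P` for the corresponding sets `D v` to cover at least `m` points. -/
def laminarComplex (D : V → Finset V) (P C : Finset V) (m : ℕ) : LowerSet (Finset V) where
  carrier := {A | A ⊆ P ∪ C ∧ m ≤ ((P \ A).biUnion D).card}
  lower' := fun _ _ hBA hA => ⟨subset_trans hBA hA.1, hA.2.trans (Finset.card_le_card
    (Finset.biUnion_subset_biUnion_of_subset_left _ (Finset.sdiff_subset_sdiff subset_rfl hBA)))⟩

theorem mem_laminarComplex {D : V → Finset V} {P C : Finset V} {m : ℕ} {A : Finset V} :
    A ∈ laminarComplex D P C m ↔ A ⊆ P ∪ C ∧ m ≤ ((P \ A).biUnion D).card := Iff.rfl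

/-- Shed an element `ρ` with the largest set. While `ρ` is missing, `D ρ` is covered: the elements
of `P` inside it cover nothing new and become cone points, and the remaining sets are disjoint from
`D ρ` by maximality. In the link, `ρ` merely leaves `P`. -/
theorem hasShelling_laminarComplex [Fintype V] (D : V → Finset V) (P C : Finset V) (m : ℕ)
    (hPC : Disjoint P C) (hself : ∀ v ∈ P, v ∈ D v)
    (htrans : ∀ u ∈ P, ∀ v ∈ P, u ∈ D v → D u ⊆ D v)
    (hlam : ∀ u ∈ P, ∀ v ∈ P, Disjoint (D u) (D v) ∨ u ∈ D v ∨ v ∈ D u) :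
    HasShelling (laminarComplex D P C m) := by
  induction hc : P.card using Nat.strong_induction_on generalizing P C m with
  | _ c ih =>
  subst hc
  rcases Nat.eq_zero_or_pos m with rfl | hm
  · exact .simplex (Q := P ∪ C) fun A => by simp [mem_laminarComplex]
  rcases P.eq_empty_or_nonempty with rfl | hne
  · refine .of_forall_notMem fun A hA => ?_
    have := (mem_laminarComplex.1 hA).2
    simp at this
    omega
  obtain ⟨ρ, hρ, hmax⟩ := Finset.exists_max_image P (fun v => (D v).card) hne
  have hdisj : ∀ v ∈ P, v ∉ D ρ → Disjoint (D ρ) (D v) := by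
    intro v hv hvρ
    rcases hlam v hv ρ hρ with h | h | h
    · exact h.symm
    · exact absurd h hvρ
    · have := Finset.eq_of_subset_of_card_le (htrans ρ hρ v hv h) (hmax v hv)
      exact absurd (this ▸ hself v hv) hvρ
  have hρC : ρ ∉ C := fun h => Finset.disjoint_left.1 hPC hρ h
  have hunion : ∀ A, ρ ∉ A → ((P \ A).biUnion D).card =
      (D ρ).card + (((P \ D ρ) \ A).biUnion D).card := by
    intro A hA
    rw [← Finset.card_union_of_disjoint]
    · congr 1
      ext y
      simp only [Finset.mem_biUnion, Finset.mem_union, Finset.mem_sdiff]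
      constructor
      · rintro ⟨v, ⟨hv, hvA⟩, hy⟩
        by_cases hvρ : v ∈ D ρ
        · exact .inl (htrans v hv ρ hρ hvρ hy)
        · exact .inr ⟨v, ⟨⟨hv, hvρ⟩, hvA⟩, hy⟩
      · rintro (hy | ⟨v, ⟨⟨hv, hvρ⟩, hvA⟩, hy⟩)
        · exact ⟨ρ, ⟨hρ, hA⟩, hy⟩
        · exact ⟨v, ⟨hv, hvA⟩, hy⟩
    · rw [Finset.disjoint_biUnion_right]
      intro v hv
      simp only [Finset.mem_sdiff] at hv
      exact hdisj v hv.1.1 hv.1.2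
  -- The truncated difference is intended: the demand drops to 0 once `D ρ` alone meets it.
  refine .of_shedding (Δd := laminarComplex D (P \ D ρ) (C ∪ (P ∩ D ρ).erase ρ) (m - (D ρ).card))
    (Δl := laminarComplex D (P.erase ρ) C m) ρ ?_ ?_ ?_ ?_ ?_
  · intro A
    rw [mem_laminarComplex, mem_laminarComplex]
    by_cases hA : ρ ∈ A
    · simp only [hA, not_true, false_and, iff_false, not_and]
      intro h
      have := h hA
      simp [hρC, hself ρ hρ] at this
    · simp only [hA, not_false_eq_true, true_and]
      rw [hunion A hA]
      refine and_congr ⟨fun h y hy => ?_, fun h y hy => ?_⟩ (by omega)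
      · have := h hy
        simp only [Finset.mem_union, Finset.mem_sdiff, Finset.mem_erase, Finset.mem_inter] at this ⊢
        tauto
      · have := h hy
        have hne : y ≠ ρ := fun h => hA (h ▸ hy)
        simp only [Finset.mem_union, Finset.mem_sdiff, Finset.mem_erase, Finset.mem_inter] at this ⊢
        tauto
  · intro A
    rw [mem_laminarComplex, mem_laminarComplex]
    have h1 : P \ insert ρ A = P.erase ρ \ A := by
      ext y; simp only [Finset.mem_sdiff, Finset.mem_insert, Finset.mem_erase]; tauto
    rw [h1, ← and_assoc]
    refine and_congr_left fun _ => ⟨fun h => ⟨fun hA => ?_, ?_⟩, fun h y hy => ?_⟩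
    · have := h hA
      simp [hρC] at this
    · refine Finset.insert_subset (Finset.mem_union_left _ hρ) (h.trans ?_)
      exact Finset.union_subset_union_left (Finset.erase_subset _ _)
    · have hne : y ≠ ρ := fun e => h.1 (e ▸ hy)
      have := h.2 (Finset.mem_insert_of_mem hy)
      simp only [Finset.mem_union, Finset.mem_erase] at this ⊢
      tauto
  · intro A hρA hA
    obtain ⟨hA1, hA2⟩ := mem_laminarComplex.1 hA
    have hne : ((P \ insert ρ A).biUnion D).Nonempty := Finset.card_pos.1 (hm.trans_le hA2)
    obtain ⟨y, hy⟩ := hne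
    obtain ⟨x₀, hx₀, -⟩ := Finset.mem_biUnion.1 hy
    -- Trade `ρ` for a missing `x` inside `D ρ` if there is one, since `D ρ` then covers all that `D
    -- x` did. Otherwise any missing `x` works: `D ρ` is disjoint from the other remaining sets and
    -- at least as large as `D x`.
    have hx : ∃ x ∈ P \ insert ρ A, x ∈ D ρ ∨ ∀ v ∈ P \ insert ρ A, v ∉ D ρ := by
      by_cases h : ∃ x ∈ P \ insert ρ A, x ∈ D ρ
      · exact h.imp fun x hx => ⟨hx.1, .inl hx.2⟩
      · exact ⟨x₀, hx₀, .inr fun v hv hvρ => h ⟨v, hv, hvρ⟩⟩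
    obtain ⟨x, hx, hxD⟩ := hx
    have hx' := hx
    simp only [Finset.mem_sdiff, Finset.mem_insert, not_or] at hx'
    obtain ⟨hxP, hxρ, hxA⟩ := hx'
    refine ⟨x, hxA, hxρ, mem_laminarComplex.2 ⟨?_, ?_⟩⟩
    · exact Finset.insert_subset (Finset.mem_union_left _ hxP)
        ((Finset.subset_insert _ _).trans hA1)
    · refine hA2.trans ?_
      have hρx : ρ ∉ insert x A := by simp [hρA, Ne.symm hxρ]
      rw [hunion _ hρx]
      obtain ⟨T, hT, hsub⟩ : ∃ T, T.card ≤ (D ρ).card ∧ (P \ insert ρ A).biUnion D ⊆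
          T ∪ ((P \ D ρ) \ insert x A).biUnion D := by
        rcases hxD with hxD | hD
        · refine ⟨D ρ, le_rfl, fun y hy => ?_⟩
          obtain ⟨v, hv, hyv⟩ := Finset.mem_biUnion.1 hy
          simp only [Finset.mem_sdiff, Finset.mem_insert, not_or] at hv
          by_cases hvD : v ∈ D ρ
          · exact Finset.mem_union_left _ (htrans v hv.1 ρ hρ hvD hyv)
          · refine Finset.mem_union_right _ (Finset.mem_biUnion.2 ⟨v, ?_, hyv⟩)
            have : v ≠ x := fun h => hvD (h ▸ hxD)
            simp [hv, hvD, this]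
        · refine ⟨D x, hmax x hxP, fun y hy => ?_⟩
          obtain ⟨v, hv, hyv⟩ := Finset.mem_biUnion.1 hy
          have hvD := hD v hv
          simp only [Finset.mem_sdiff, Finset.mem_insert, not_or] at hv
          by_cases hvx : v = x
          · exact Finset.mem_union_left _ (hvx ▸ hyv)
          · refine Finset.mem_union_right _ (Finset.mem_biUnion.2 ⟨v, ?_, hyv⟩)
            simp [hv, hvD, hvx]
      exact (Finset.card_le_card hsub).trans
        ((Finset.card_union_le _ _).trans (Nat.add_le_add_right hT _))
  · have hsub : P \ D ρ ⊆ P := Finset.sdiff_subset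
    refine ih _ ?_ _ _ _ ?_ (fun v hv => hself v (hsub hv))
      (fun u hu v hv => htrans u (hsub hu) v (hsub hv))
      (fun u hu v hv => hlam u (hsub hu) v (hsub hv)) rfl
    · refine Finset.card_lt_card (Finset.ssubset_iff_of_subset hsub |>.2 ⟨ρ, hρ, ?_⟩)
      simp [hself ρ hρ]
    · rw [Finset.disjoint_left] at hPC ⊢
      intro y hy
      have := hPC (hsub hy)
      simp only [Finset.mem_sdiff, Finset.mem_union, Finset.mem_erase, Finset.mem_inter] at hy ⊢
      tauto
  · have hsub : P.erase ρ ⊆ P := Finset.erase_subset _ _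
    exact ih _ (Finset.card_erase_lt_of_mem hρ) _ _ _ (hPC.mono_left hsub)
      (fun v hv => hself v (hsub hv))
      (fun u hu v hv => htrans u (hsub hu) v (hsub hv))
      (fun u hu v hv => hlam u (hsub hu) v (hsub hv)) rfl

/-! ### Complexes with one nonface generator or two disjoint ones. -/

/-- The subsets of `Q` containing no member of `𝓑`. -/
def avoidingComplex (Q : Finset V) (𝓑 : Set (Finset V)) : LowerSet (Finset V) where
  carrier := {A | A ⊆ Q ∧ ∀ B ∈ 𝓑, ¬ B ⊆ A}
  lower' := fun _ _ hBA hA => ⟨subset_trans hBA hA.1, fun B hB h => hA.2 B hB (h.trans hBA)⟩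

omit [DecidableEq V] in
theorem mem_avoidingComplex {Q : Finset V} {𝓑 : Set (Finset V)} {A : Finset V} :
    A ∈ avoidingComplex Q 𝓑 ↔ A ⊆ Q ∧ ∀ B ∈ 𝓑, ¬ B ⊆ A := Iff.rfl

theorem hasShelling_avoidingComplex_singleton [Fintype V] {Q B : Finset V} (hB : B ⊆ Q) :
    HasShelling (avoidingComplex Q {B}) := by
  -- With singletons and `m = 1`, the covering condition says that some element of `B` is missing.
  have h := hasShelling_laminarComplex (fun v => {v}) B (Q \ B) 1 Finset.disjoint_sdiff
    (by simp) (by simp) (fun u _ v _ => by simp [eq_comm, or_iff_not_imp_right])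
  convert h using 1
  ext A
  change A ∈ avoidingComplex Q {B} ↔ A ∈ laminarComplex _ _ _ _
  rw [mem_avoidingComplex, mem_laminarComplex, Finset.union_sdiff_of_subset hB,
    Finset.biUnion_singleton_eq_self, Nat.one_le_iff_ne_zero, Finset.card_ne_zero,
    Finset.sdiff_nonempty]
  simp

/-- Every `a ∈ A` is shed: deleting it makes avoidance of `A` automatic, linking it shrinks `A`, and
it can be traded for a missing element of `A`, which does not affect `B`. -/
theorem hasShelling_avoidingComplex_pair [Fintype V] {Q A B : Finset V} (hA : A ⊆ Q) (hB : B ⊆ Q)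
    (hAB : Disjoint A B) : HasShelling (avoidingComplex Q {A, B}) := by
  induction hc : A.card generalizing A Q with
  | zero =>
    rw [Finset.card_eq_zero] at hc
    subst hc
    exact .of_forall_notMem fun T hT => (mem_avoidingComplex.1 hT).2 ∅ (by simp) (by simp)
  | succ n ih =>
    obtain ⟨a, ha⟩ : A.Nonempty := Finset.card_pos.1 (by omega)
    have haB : a ∉ B := Finset.disjoint_left.1 hAB ha
    refine .of_shedding (Δd := avoidingComplex (Q.erase a) {B})
      (Δl := avoidingComplex (Q.erase a) {A.erase a, B}) a ?_ ?_ ?_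
      (hasShelling_avoidingComplex_singleton (Finset.subset_erase.2 ⟨hB, haB⟩))
      (ih (Finset.erase_subset_erase a hA) (Finset.subset_erase.2 ⟨hB, haB⟩)
        (hAB.mono_left (Finset.erase_subset a A)) (by rw [Finset.card_erase_of_mem ha]; omega))
    · intro T
      have : a ∉ T → ¬ A ⊆ T := fun h h' => h (h' ha)
      simp only [mem_avoidingComplex, Finset.subset_erase, Set.mem_singleton_iff, forall_eq,
        Set.mem_insert_iff, forall_eq_or_imp]
      tauto
    · intro T
      have h1 : B ⊆ insert a T ↔ B ⊆ T := Finset.subset_insert_iff_of_notMem haB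
      simp only [mem_avoidingComplex, Finset.subset_erase, Set.mem_singleton_iff, forall_eq,
        Set.mem_insert_iff, forall_eq_or_imp, Finset.insert_subset_iff, hA ha, true_and, h1,
        Finset.subset_insert_iff (s := A)]
      tauto
    · intro T haT hT
      simp only [mem_avoidingComplex, Set.mem_singleton_iff, forall_eq, Set.mem_insert_iff,
        forall_eq_or_imp, Finset.insert_subset_iff] at hT ⊢
      obtain ⟨x, hxA, hxT⟩ := Finset.not_subset.1 hT.2.1
      rw [Finset.mem_insert, not_or] at hxT
      have hxB : x ∉ B := Finset.disjoint_left.1 hAB hxA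
      refine ⟨x, hxT.2, hxT.1, ⟨hA hxA, hT.1.2⟩, fun h => ?_, fun h => hT.2.2 ?_⟩
      · have := h ha
        simp [haT, Ne.symm hxT.1] at this
      · rw [Finset.subset_insert_iff_of_notMem hxB] at h
        exact h.trans (Finset.subset_insert _ _)

end Shelling

/-! ### Connected vertex sets and separation in forests. -/

section Connectivity

variable {V : Type*} {G : SimpleGraph V} {Q Q' K : Finset V} {x a b : V}

theorem SimpleGraph.Reachable.mem_of_closed {H : SimpleGraph V} {u : V} (h : H.Reachable a u)
    {S : V → Prop} (ha : S a) (hS : ∀ b c, S b → H.Adj b c → S c) : S u := by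
  rw [SimpleGraph.reachable_iff_reflTransGen] at h
  induction h with
  | refl => exact ha
  | tail _ hbc ih => exact hS _ _ ih hbc

/-- The graph on all of `V` whose edges are the edges of `G` inside `Q`. -/
def restrictTo (G : SimpleGraph V) (Q : Finset V) : SimpleGraph V where
  Adj a b := G.Adj a b ∧ a ∈ Q ∧ b ∈ Q
  symm := ⟨fun _ _ h => ⟨h.1.symm, h.2.2, h.2.1⟩⟩
  loopless := ⟨fun _ h => h.1.ne rfl⟩

theorem restrictTo_mono (h : Q ⊆ Q') : restrictTo G Q ≤ restrictTo G Q' :=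
  fun _ _ hab => ⟨hab.1, h hab.2.1, h hab.2.2⟩

theorem mem_of_reachable_restrictTo (h : (restrictTo G Q).Reachable a b) (ha : a ∈ Q) : b ∈ Q :=
  h.mem_of_closed (S := (· ∈ Q)) ha fun _ _ _ hbc => hbc.2.2

/-- `K` induces a connected (or empty) subgraph. -/
def ConnectedOn (G : SimpleGraph V) (K : Finset V) : Prop :=
  ∀ a ∈ K, ∀ b ∈ K, (restrictTo G K).Reachable a b

open Classical in
/-- The vertices reachable from `x` inside `Q`. -/
noncomputable def reachSet [Fintype V] (G : SimpleGraph V) (Q : Finset V) (x : V) : Finset V :=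
  {u | (restrictTo G Q).Reachable x u}

section Fintype

variable [Fintype V]

theorem mem_reachSet : a ∈ reachSet G Q x ↔ (restrictTo G Q).Reachable x a := by
  simp [reachSet]

theorem self_mem_reachSet : x ∈ reachSet G Q x := mem_reachSet.2 (SimpleGraph.Reachable.refl x)

theorem reachSet_subset (hx : x ∈ Q) : reachSet G Q x ⊆ Q :=
  fun _ h => mem_of_reachable_restrictTo (mem_reachSet.1 h) hx

theorem reachSet_mono (h : Q ⊆ Q') : reachSet G Q x ⊆ reachSet G Q' x :=
  fun _ hu => mem_reachSet.2 ((mem_reachSet.1 hu).mono (restrictTo_mono h))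

theorem mem_reachSet_of_adj (ha : a ∈ reachSet G Q x) (hab : G.Adj a b) (haQ : a ∈ Q)
    (hbQ : b ∈ Q) : b ∈ reachSet G Q x :=
  mem_reachSet.2 ((mem_reachSet.1 ha).trans (SimpleGraph.Adj.reachable ⟨hab, haQ, hbQ⟩))

theorem connectedOn_reachSet : ConnectedOn G (reachSet G Q x) := by
  have key : ∀ u ∈ reachSet G Q x, (restrictTo G (reachSet G Q x)).Reachable x u := by
    intro u hu
    refine ((mem_reachSet.1 hu).mem_of_closed
      (S := fun u => u ∈ reachSet G Q x ∧ (restrictTo G (reachSet G Q x)).Reachable x u)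
      ⟨self_mem_reachSet, SimpleGraph.Reachable.refl x⟩ ?_).2
    rintro b c ⟨hb, hxb⟩ hbc
    have hc := mem_reachSet_of_adj hb hbc.1 hbc.2.1 hbc.2.2
    exact ⟨hc, hxb.trans (SimpleGraph.Adj.reachable ⟨hbc.1, hb, hc⟩)⟩
  exact fun a ha b hb => (key a ha).symm.trans (key b hb)

theorem ConnectedOn.subset_reachSet (hK : ConnectedOn G K) (hKQ : K ⊆ Q) (hx : x ∈ K) :
    K ⊆ reachSet G Q x :=
  fun u hu => mem_reachSet.2 ((hK x hx u hu).mono (restrictTo_mono hKQ))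

end Fintype

theorem ConnectedOn.subset_of_closed (hK : ConnectedOn G K) (hx : x ∈ K) {S : V → Prop} (hxS : S x)
    (hS : ∀ b ∈ K, ∀ c ∈ K, S b → G.Adj b c → S c) : ∀ u ∈ K, S u := fun u hu =>
  (hK x hx u hu).mem_of_closed hxS fun b c hb hbc => hS b hbc.2.1 c hbc.2.2 hb hbc.1

/-- A connected subset lies in one component, and components are connected; this form replaces the
components of induced subgraphs from here on. -/
theorem isRIndependent_iff [Fintype V] {r : ℕ} {A : Finset V} :
    IsRIndependent G r A ↔ ∀ K ⊆ A, ConnectedOn G K → K.card ≤ r := by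
  classical
  constructor
  · intro h K hKA hK
    rcases K.eq_empty_or_nonempty with rfl | ⟨x, hx⟩
    · simp
    let c := (G.induce (A : Set V)).connectedComponentMk ⟨x, hKA hx⟩
    refine le_trans ?_ (h c)
    have hsub : (K : Set V) ⊆ Subtype.val '' c.supp := by
      intro u hu
      refine hK.subset_of_closed hx (S := fun u => u ∈ Subtype.val '' c.supp)
        ⟨⟨x, hKA hx⟩, rfl, rfl⟩ ?_ u hu
      rintro _ hb d hd ⟨⟨b, hbA⟩, hbc, rfl⟩ hbd
      refine ⟨⟨d, hKA hd⟩, ?_, rfl⟩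
      rw [SimpleGraph.ConnectedComponent.mem_supp_iff] at hbc ⊢
      rw [← hbc, SimpleGraph.ConnectedComponent.eq]
      exact (SimpleGraph.Adj.reachable (by simpa using hbd)).symm
    rw [← Set.ncard_coe_finset K, ← Set.ncard_image_of_injective _ Subtype.val_injective]
    exact Set.ncard_le_ncard hsub (Set.toFinite _)
  · intro h c
    induction c using SimpleGraph.ConnectedComponent.ind with
    | _ x =>
    obtain ⟨x, hx⟩ := x
    set c := (G.induce (A : Set V)).connectedComponentMk ⟨x, hx⟩ with hc
    refine le_trans ?_ (h (reachSet G A x) (reachSet_subset hx) connectedOn_reachSet)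
    rw [← Set.ncard_coe_finset, ← Set.ncard_image_of_injective c.supp Subtype.val_injective]
    refine Set.ncard_le_ncard ?_ (Set.toFinite _)
    rintro _ ⟨u, hu, rfl⟩
    rw [SimpleGraph.ConnectedComponent.mem_supp_iff, hc, SimpleGraph.ConnectedComponent.eq] at hu
    refine hu.symm.mem_of_closed (S := fun u => (u : V) ∈ (reachSet G A x : Set V))
      (Finset.mem_coe.2 self_mem_reachSet) ?_
    intro b d hb hbd
    exact Finset.mem_coe.2 (mem_reachSet_of_adj (Finset.mem_coe.1 hb) (by simpa using hbd)
      b.2 d.2)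

/-- Every edge of a forest is a bridge. -/
theorem SimpleGraph.IsAcyclic.not_reachable (hG : G.IsAcyclic) {H : SimpleGraph V} (hab : G.Adj a b)
    (hH : H ≤ G) (hHab : ¬ H.Adj a b) : ¬ H.Reachable a b := by
  have h := SimpleGraph.isBridge_iff.1 (SimpleGraph.isAcyclic_iff_forall_adj_isBridge.1 hG hab)
  refine fun h' => h (h'.mono ?_)
  intro u v huv
  rw [SimpleGraph.deleteEdges_adj]
  refine ⟨hH huv, fun he => hHab ?_⟩
  rcases Sym2.eq_iff.1 (Set.mem_singleton_iff.1 he) with ⟨rfl, rfl⟩ | ⟨rfl, rfl⟩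
  · exact huv
  · exact huv.symm

/-- In a forest, a vertex has at most one neighbour in each component of the rest. -/
theorem SimpleGraph.IsAcyclic.eq_of_adj_of_reachable (hG : G.IsAcyclic) {y z : V} (hx : x ∉ Q)
    (hy : G.Adj x y) (hz : G.Adj x z) (h : (restrictTo G Q).Reachable y z) : y = z := by
  by_contra hne
  refine hG.not_reachable (H := G.deleteEdges {s(x, y)}) hy (SimpleGraph.deleteEdges_le _)
    (by simp) ?_
  have h1 : (G.deleteEdges {s(x, y)}).Adj x z := by
    rw [SimpleGraph.deleteEdges_adj]
    refine ⟨hz, fun he => ?_⟩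
    rcases Sym2.eq_iff.1 (Set.mem_singleton_iff.1 he) with ⟨-, h⟩ | ⟨h, -⟩
    · exact hne h.symm
    · exact hy.ne h
  refine h1.reachable.trans (h.symm.mono ?_)
  intro u v huv
  rw [SimpleGraph.deleteEdges_adj]
  refine ⟨huv.1, fun he => ?_⟩
  rcases Sym2.eq_iff.1 (Set.mem_singleton_iff.1 he) with ⟨rfl, -⟩ | ⟨-, rfl⟩
  · exact hx huv.2.1
  · exact hx huv.2.2

/-- In a forest, at most one edge joins two disjoint connected sets. -/
theorem SimpleGraph.IsAcyclic.eq_of_adj_of_connectedOn (hG : G.IsAcyclic) {A B : Finset V}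
    {a' b' : V} (hA : ConnectedOn G A) (hB : ConnectedOn G B) (hAB : Disjoint A B)
    (ha : a ∈ A) (hb : b ∈ B) (hab : G.Adj a b) (ha' : a' ∈ A) (hb' : b' ∈ B)
    (hab' : G.Adj a' b') : a = a' ∧ b = b' := by
  classical
  rw [Finset.disjoint_left] at hAB
  by_contra hne
  have h1 : (G.deleteEdges {s(a, b)}).Adj a' b' := by
    rw [SimpleGraph.deleteEdges_adj]
    refine ⟨hab', fun he => ?_⟩
    rcases Sym2.eq_iff.1 (Set.mem_singleton_iff.1 he) with ⟨h, h'⟩ | ⟨h, h'⟩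
    · exact hne ⟨h.symm, h'.symm⟩
    · exact hAB ha' (h ▸ hb)
  refine hG.not_reachable (H := G.deleteEdges {s(a, b)}) hab (SimpleGraph.deleteEdges_le _)
    (by simp) ?_
  refine ((hA a ha a' ha').mono ?_).trans (h1.reachable.trans ((hB b' hb' b hb).mono ?_))
  · intro u v huv
    rw [SimpleGraph.deleteEdges_adj]
    refine ⟨huv.1, fun he => ?_⟩
    rcases Sym2.eq_iff.1 (Set.mem_singleton_iff.1 he) with ⟨-, rfl⟩ | ⟨rfl, -⟩
    · exact hAB huv.2.2 hb
    · exact hAB huv.2.1 hb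
  · intro u v huv
    rw [SimpleGraph.deleteEdges_adj]
    refine ⟨huv.1, fun he => ?_⟩
    rcases Sym2.eq_iff.1 (Set.mem_singleton_iff.1 he) with ⟨rfl, -⟩ | ⟨-, rfl⟩
    · exact hAB ha huv.2.1
    · exact hAB ha huv.2.2

theorem SimpleGraph.Walk.reachable_restrictTo {u v : V} (p : G.Walk u v) :
    (∀ w ∈ p.support, w ∈ Q) → (restrictTo G Q).Reachable u v := by
  induction p with
  | nil => exact fun _ => SimpleGraph.Reachable.refl _
  | cons h p ih =>
    intro hw
    simp only [SimpleGraph.Walk.support_cons, List.mem_cons, forall_eq_or_imp] at hw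
    have hadj : (restrictTo G Q).Adj _ _ := ⟨h, hw.1, hw.2 _ p.start_mem_support⟩
    exact hadj.reachable.trans (ih hw.2)

theorem exists_walk_of_reachable_restrictTo {u v : V} (h : (restrictTo G Q).Reachable u v)
    (hu : u ∈ Q) : ∃ p : G.Walk u v, ∀ w ∈ p.support, w ∈ Q := by
  obtain ⟨p⟩ := h
  induction p with
  | nil => exact ⟨.nil, by simpa using hu⟩
  | cons h p ih =>
    obtain ⟨q, hq⟩ := ih h.2.2
    exact ⟨.cons h.1 q, by simpa using ⟨hu, hq⟩⟩

/-- In a forest, two vertices which are connected, but not inside `Q`, are separated by a single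
vertex outside `Q`. -/
theorem SimpleGraph.IsAcyclic.exists_separating_vertex [Fintype V] [DecidableEq V]
    (hG : G.IsAcyclic) {u : V} (hu : u ∈ reachSet G Finset.univ x) (huQ : u ∉ reachSet G Q x)
    (hx : x ∈ Q) : ∃ v ∉ Q, u ∉ reachSet G (Finset.univ.erase v) x := by
  obtain ⟨p, -⟩ := exists_walk_of_reachable_restrictTo (mem_reachSet.1 hu) (Finset.mem_univ x)
  by_contra! hcon
  refine huQ (mem_reachSet.2 (p.bypass.reachable_restrictTo fun w hw => ?_))
  by_contra hwQ
  -- If `w` did not separate, a walk `q` would avoid it; but the path from `x` to `u` is unique and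
  -- passes through `w`.
  obtain ⟨q, hq⟩ := exists_walk_of_reachable_restrictTo (mem_reachSet.1 (hcon w hwQ))
    (by simpa using fun h : x = w => hwQ (h ▸ hx))
  have := (hG.subsingleton_path x u).elim p.toPath q.toPath
  have h2 : p.bypass = q.bypass := congrArg Subtype.val this
  rw [h2] at hw
  simpa using hq w (q.support_bypass_subset_support hw)

/-! ### The size of the component of a fixed vertex. -/

/-- In a forest, the sets `A` for which the component of `x` in `A ∪ R` has at most `r` vertices
form a shellable complex. -/
theorem hasShelling_of_reachSet_card_le [Fintype V] [DecidableEq V] (hG : G.IsAcyclic)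
    {R : Finset V} (hx : x ∈ R) (r : ℕ) {Δ : LowerSet (Finset V)}
    (hΔ : ∀ A, A ∈ Δ ↔ Disjoint A R ∧ (reachSet G (A ∪ R) x).card ≤ r) : HasShelling Δ := by
  set X := reachSet G Finset.univ x with hX
  -- With the component `X` rooted at `x`, for `v ∈ X \ R` this is the set of descendants of `v`,
  -- including `v`.
  set D : V → Finset V := fun v => X \ reachSet G (Finset.univ.erase v) x with hD
  have memD : ∀ u v, u ∈ D v ↔ u ∈ X ∧ u ∉ reachSet G (Finset.univ.erase v) x := by
    simp [hD]
  have hne : ∀ v ∈ X \ R, v ≠ x := fun v hv h => (Finset.mem_sdiff.1 hv).2 (h ▸ hx)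
  have hadj : ∀ {v b c : V}, b ∈ reachSet G (Finset.univ.erase v) x → v ≠ x → G.Adj b c → c ≠ v →
      c ∈ reachSet G (Finset.univ.erase v) x := by
    intro v b c hb hv hbc hcv
    refine mem_reachSet_of_adj hb hbc (reachSet_subset (by simpa using hv.symm) hb) (by simpa)
  -- At least `X.card - r` vertices must be cut off (none if `X` is small). Vertices outside `X ∪ R`
  -- are cone points.
  have h := hasShelling_laminarComplex D (X \ R) (Finset.univ \ (X ∪ R)) (X.card - r) ?_ ?_ ?_ ?_
  · convert h using 1
    ext A
    change A ∈ Δ ↔ A ∈ laminarComplex _ _ _ _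
    rw [hΔ, mem_laminarComplex]
    refine and_congr ⟨fun h y hy => ?_, fun h => Finset.disjoint_left.2 fun y hy => ?_⟩ ?_
    · have := Finset.disjoint_left.1 h hy
      simp only [Finset.mem_union, Finset.mem_sdiff, Finset.mem_univ, true_and]
      tauto
    · have := h hy
      simp only [Finset.mem_union, Finset.mem_sdiff, Finset.mem_univ, true_and] at this
      tauto
    · have : reachSet G (A ∪ R) x = X \ (((X \ R) \ A).biUnion D) := by
        ext u
        simp only [Finset.mem_sdiff, Finset.mem_biUnion, memD, not_exists, not_and, not_not]
        constructor
        · intro hu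
          refine ⟨reachSet_mono (Finset.subset_univ _) hu, fun v hv _ => reachSet_mono ?_ hu⟩
          intro y hy
          refine Finset.mem_erase.2 ⟨?_, Finset.mem_univ y⟩
          rintro rfl
          rcases Finset.mem_union.1 hy with h | h
          exacts [hv.2 h, hv.1.2 h]
        · rintro ⟨hu, h⟩
          by_contra hu'
          obtain ⟨v, hv, huv⟩ :=
            hG.exists_separating_vertex hu hu' (Finset.mem_union_right A hx)
          rw [Finset.mem_union, not_or] at hv
          by_cases hvX : v ∈ X
          · exact huv (h v ⟨⟨hvX, hv.2⟩, hv.1⟩ hu)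
          · refine huv ?_
            refine (mem_reachSet.1 hu).mem_of_closed
              (S := fun u => u ∈ X ∧ u ∈ reachSet G (Finset.univ.erase v) x)
              ⟨self_mem_reachSet, self_mem_reachSet⟩ ?_ |>.2
            rintro b c ⟨hbX, hb⟩ hbc
            have hcX : c ∈ X := mem_reachSet_of_adj hbX hbc.1 (by simp) (by simp)
            exact ⟨hcX, hadj hb (fun h => hvX (h ▸ self_mem_reachSet)) hbc.1
              fun h => hvX (h ▸ hcX)⟩
      rw [this, Finset.card_sdiff_of_subset]
      · omega
      · intro u hu
        obtain ⟨v, -, hv⟩ := Finset.mem_biUnion.1 hu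
        exact ((memD u v).1 hv).1
  · rw [Finset.disjoint_left]
    intro y hy
    simp only [Finset.mem_union, Finset.mem_sdiff, Finset.mem_univ, true_and] at hy ⊢
    tauto
  · intro v hv
    refine (memD v v).2 ⟨(Finset.mem_sdiff.1 hv).1, fun h => ?_⟩
    have := reachSet_subset (by simpa using (hne v hv).symm) h
    simp at this
  · intro u hu v hv huv w hw
    rw [memD] at huv hw ⊢
    refine ⟨hw.1, fun hwv => hw.2 ?_⟩
    refine (mem_reachSet.1 hwv).mem_of_closed
      (S := fun w => w ∈ reachSet G (Finset.univ.erase v) x ∧ w ∈ reachSet G (Finset.univ.erase u) x)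
      ⟨self_mem_reachSet, self_mem_reachSet⟩ ?_ |>.2
    rintro b c ⟨hb, hb'⟩ hbc
    have hc := hadj hb (hne v hv) hbc.1 (Finset.ne_of_mem_erase hbc.2.2)
    exact ⟨hc, hadj hb' (hne u hu) hbc.1 fun h => huv.2 (h ▸ hc)⟩
  · intro u hu v hv
    by_contra! hcon
    obtain ⟨hnd, huv, hvu⟩ := hcon
    obtain ⟨w, hwu, hwv⟩ := Finset.not_disjoint_iff.1 hnd
    rw [memD] at huv hvu hwu hwv
    have huX := (Finset.mem_sdiff.1 hu).1
    have hvX := (Finset.mem_sdiff.1 hv).1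
    have huv' : u ∈ reachSet G (Finset.univ.erase v) x := by tauto
    have hvu' : v ∈ reachSet G (Finset.univ.erase u) x := by tauto
    -- If neither of `u`, `v` is below the other, no edge leaves the union of these two sets: the
    -- only exit from the one avoiding `v` is `v`, which lies in the other, and symmetrically.
    have : w ∈ reachSet G (Finset.univ.erase v) x ∨ w ∈ reachSet G (Finset.univ.erase u) x := by
      refine (mem_reachSet.1 hwu.1).mem_of_closed (S := fun w =>
        w ∈ reachSet G (Finset.univ.erase v) x ∨ w ∈ reachSet G (Finset.univ.erase u) x)
        (.inl self_mem_reachSet) ?_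
      rintro b c (hb | hb) hbc
      · by_cases hcv : c = v
        · exact .inr (hcv ▸ hvu')
        · exact .inl (hadj hb (hne v hv) hbc.1 hcv)
      · by_cases hcu : c = u
        · exact .inl (hcu ▸ huv')
        · exact .inr (hadj hb (hne u hu) hbc.1 hcu)
    tauto

/-! ### Descent to a minimal nonface branch. -/

/-- If `P` is not a face of `Δ` and the nonfaces of `Δ` contain connected nonfaces, then some
`x ∈ P` is completed to a nonface by a face `Y` which is a union of components of `P \ x` and
contains all but one of the neighbours of `x`. -/
theorem SimpleGraph.IsAcyclic.exists_penultimate [Fintype V] [DecidableEq V] (hG : G.IsAcyclic)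
    {Δ : LowerSet (Finset V)} (hconn : ∀ A ∉ Δ, ∃ K ⊆ A, K ∉ Δ ∧ ConnectedOn G K)
    (hempty : ∅ ∈ Δ) {P : Finset V} (hP : P ∉ Δ) :
    ∃ x ∈ P, ∃ Y ⊆ P.erase x, (∀ u ∈ Y, ∀ w ∈ P.erase x, G.Adj u w → w ∈ Y) ∧
      (∃ q, ∀ w ∈ P, G.Adj x w → w ≠ q → w ∈ Y) ∧ insert x Y ∉ Δ ∧ Y ∈ Δ := by
  suffices h : ∀ n, ∀ x ∈ P, ∀ Y ⊆ P.erase x, Y.card = n →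
      (∀ u ∈ Y, ∀ w ∈ P.erase x, G.Adj u w → w ∈ Y) →
      (∃ q, ∀ w ∈ P, G.Adj x w → w ≠ q → w ∈ Y) → insert x Y ∉ Δ →
      ∃ x ∈ P, ∃ Y ⊆ P.erase x, (∀ u ∈ Y, ∀ w ∈ P.erase x, G.Adj u w → w ∈ Y) ∧
        (∃ q, ∀ w ∈ P, G.Adj x w → w ≠ q → w ∈ Y) ∧ insert x Y ∉ Δ ∧ Y ∈ Δ by
    obtain ⟨x, hx⟩ : P.Nonempty := Finset.nonempty_iff_ne_empty.2 fun h => hP (h ▸ hempty)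
    -- At the start no neighbour is excluded, so `q = x` is a dummy.
    refine h _ x hx (P.erase x) subset_rfl rfl (fun _ _ _ h _ => h) ⟨x, fun w hw _ hwx => ?_⟩ ?_
    · exact Finset.mem_erase.2 ⟨hwx, hw⟩
    · rwa [Finset.insert_erase hx]
  intro n
  induction n using Nat.strong_induction_on with
  | _ n ih =>
  rintro x hx Y hYP rfl hcl hq hins
  by_cases hY : Y ∈ Δ
  · exact ⟨x, hx, Y, hYP, hcl, hq, hins, hY⟩
  obtain ⟨K, hKY, hK, hKc⟩ := hconn Y hY
  obtain ⟨k, hk⟩ : K.Nonempty := Finset.nonempty_iff_ne_empty.2 fun h => hK (h ▸ hempty)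
  set Z := reachSet G Y k with hZ
  have hZY : Z ⊆ Y := reachSet_subset (hKY hk)
  have hZΔ : Z ∉ Δ := fun h => hK (Δ.lower (hKc.subset_reachSet hKY hk) h)
  have hxY : x ∉ Y := fun h => Finset.notMem_erase x P (hYP h)
  -- The descent moves to the component `Z` of `Y`, still a nonface, and to the only vertex of `Z`
  -- that can be adjacent to `x`. From `z`, the vertex left behind is the excluded neighbour `q`.
  obtain ⟨z, hz, hzx⟩ : ∃ z ∈ Z, ∀ w ∈ Z, G.Adj x w → w = z := by
    by_cases h : ∃ z ∈ Z, G.Adj x z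
    · obtain ⟨z, hz, hxz⟩ := h
      exact ⟨z, hz, fun w hw hxw => hG.eq_of_adj_of_reachable hxY hxw hxz
        ((mem_reachSet.1 hw).symm.trans (mem_reachSet.1 hz))⟩
    · exact ⟨k, self_mem_reachSet, fun w hw hxw => absurd ⟨w, hw, hxw⟩ h⟩
  have hZcl : ∀ u ∈ Z, ∀ w ∈ P.erase x, G.Adj u w → w ∈ Z := fun u hu w hw huw =>
    mem_reachSet_of_adj hu huw (hZY hu) (hcl u (hZY hu) w hw huw)
  have hZP : Z ⊆ P := (hZY.trans hYP).trans (Finset.erase_subset _ _)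
  refine ih (Z.erase z).card ?_ z (hZP hz) (Z.erase z) (Finset.erase_subset_erase z hZP) rfl
    ?_ ⟨x, ?_⟩ (by rwa [Finset.insert_erase hz])
  · exact (Finset.card_erase_lt_of_mem hz).trans_le (Finset.card_le_card hZY)
  · intro u hu w hw huw
    obtain ⟨huz, hu⟩ := Finset.mem_erase.1 hu
    obtain ⟨hwz, hw⟩ := Finset.mem_erase.1 hw
    refine Finset.mem_erase.2 ⟨hwz, hZcl u hu w (Finset.mem_erase.2 ⟨?_, hw⟩) huw⟩
    rintro rfl
    exact huz (hzx u hu huw.symm)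
  · intro w hw hzw hwx
    exact Finset.mem_erase.2 ⟨hzw.ne', hZcl z hz w (Finset.mem_erase.2 ⟨hwx, hw⟩) hzw⟩

end Connectivity

/-! ### Vertex sets inducing maximum degree at most one. -/

section Sparse

variable {V : Type*} [DecidableEq V] {G : SimpleGraph V} {P H L A : Finset V}

/-- The faces of `sparseComplex G P H` are the subsets of `P` inducing a graph of maximum degree
at most one in which the vertices of `H` are isolated. -/
def sparseComplex (G : SimpleGraph V) (P H : Finset V) : LowerSet (Finset V) where
  carrier := {A | A ⊆ P ∧ ∀ v ∈ A, ∀ y ∈ A, G.Adj v y → v ∉ H ∧ ∀ z ∈ A, G.Adj v z → z = y}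
  lower' := fun _ _ hBA hA => ⟨subset_trans hBA hA.1, fun v hv y hy hvy =>
    (hA.2 v (hBA hv) y (hBA hy) hvy).imp_right fun h z hz => h z (hBA hz)⟩

omit [DecidableEq V] in
theorem mem_sparseComplex : A ∈ sparseComplex G P H ↔
    A ⊆ P ∧ ∀ v ∈ A, ∀ y ∈ A, G.Adj v y → v ∉ H ∧ ∀ z ∈ A, G.Adj v z → z = y := Iff.rfl

/-- The faces of `sparseComplex G P H` having at most one vertex in `L`. -/
def sparseComplexAtMostOne (G : SimpleGraph V) (P H L : Finset V) : LowerSet (Finset V) where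
  carrier := {A | A ∈ sparseComplex G P H ∧ ∀ u ∈ A, ∀ v ∈ A, u ∈ L → v ∈ L → u = v}
  lower' := fun _ _ hBA hA => ⟨(sparseComplex G P H).lower hBA hA.1,
    fun u hu v hv => hA.2 u (hBA hu) v (hBA hv)⟩

omit [DecidableEq V] in
theorem mem_sparseComplexAtMostOne : A ∈ sparseComplexAtMostOne G P H L ↔
    A ∈ sparseComplex G P H ∧ ∀ u ∈ A, ∀ v ∈ A, u ∈ L → v ∈ L → u = v := Iff.rfl

theorem mem_sparseComplex_erase {v : V} :
    A ∈ sparseComplex G (P.erase v) H ↔ v ∉ A ∧ A ∈ sparseComplex G P H := by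
  rw [mem_sparseComplex, mem_sparseComplex, Finset.subset_erase]
  tauto

/-- Adding a vertex without neighbours preserves sparseness. -/
theorem insert_mem_sparseComplex_of_not_adj {y : V} (hA : A ∈ sparseComplex G P H) (hy : y ∈ P)
    (h : ∀ z ∈ A, ¬ G.Adj y z) : insert y A ∈ sparseComplex G P H := by
  rw [mem_sparseComplex] at hA ⊢
  refine ⟨Finset.insert_subset hy hA.1, ?_⟩
  simp only [Finset.forall_mem_insert, SimpleGraph.irrefl, false_imp_iff, true_and]
  refine ⟨fun z hz hyz => absurd hyz (h z hz), fun v hv => ⟨fun hvy => absurd hvy.symm (h v hv),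
    fun z hz hvz => ⟨(hA.2 v hv z hz hvz).1, fun hvy => absurd hvy.symm (h v hv),
      (hA.2 v hv z hz hvz).2⟩⟩⟩

/-- The link of a vertex of `H`. -/
theorem insert_mem_sparseComplex_of_mem [Fintype V] [DecidableRel G.Adj] {v : V} (hvP : v ∈ P)
    (hv : v ∈ H) : (v ∉ A ∧ insert v A ∈ sparseComplex G P H) ↔
      A ∈ sparseComplex G (P.erase v \ G.neighborFinset v) H := by
  constructor
  · rintro ⟨hvA, h⟩
    have h0 := (sparseComplex G P H).lower (Finset.subset_insert v A) h
    refine ⟨fun y hy => ?_, h0.2⟩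
    rw [Finset.mem_sdiff, Finset.mem_erase, SimpleGraph.mem_neighborFinset]
    refine ⟨⟨fun e => hvA (e ▸ hy), h0.1 hy⟩, fun hvy => ?_⟩
    exact (h.2 v (Finset.mem_insert_self v A) y (Finset.mem_insert_of_mem hy) hvy).1 hv
  · intro h
    have hA : ∀ z ∈ A, (z ≠ v ∧ z ∈ P) ∧ ¬ G.Adj v z := fun z hz => by
      simpa using h.1 hz
    exact ⟨fun hvA => (hA v hvA).1.1 rfl, insert_mem_sparseComplex_of_not_adj
      ⟨fun z hz => (hA z hz).1.2, h.2⟩ hvP fun z hz => (hA z hz).2⟩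

/-- The link of a vertex outside `H`. -/
theorem insert_mem_sparseComplex_of_notMem [Fintype V] [DecidableRel G.Adj] {v : V} (hvP : v ∈ P)
    (hv : v ∉ H) : (v ∉ A ∧ insert v A ∈ sparseComplex G P H) ↔
      A ∈ sparseComplexAtMostOne G (P.erase v \ (G.neighborFinset v ∩ H))
        (H ∪ ((P ∩ G.neighborFinset v) \ H)) ((P ∩ G.neighborFinset v) \ H) := by
  simp only [mem_sparseComplexAtMostOne, mem_sparseComplex, Finset.mem_union, Finset.mem_sdiff,
    Finset.mem_inter, SimpleGraph.mem_neighborFinset, Finset.subset_iff, Finset.mem_erase]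
  simp only [Finset.forall_mem_insert, SimpleGraph.irrefl, false_imp_iff, true_and]
  constructor
  · rintro ⟨hvA, ⟨-, hAP⟩, hv1, hA⟩
    have hnv : ∀ y ∈ A, y ≠ v := fun y hy e => hvA (e ▸ hy)
    refine ⟨⟨fun y hy => ⟨⟨hnv y hy, hAP y hy⟩, fun h => ?_⟩, fun u hu y hy huy => ⟨?_, ?_⟩⟩, ?_⟩
    · exact ((hA y hy).1 h.1.symm).1 h.2
    · rintro (h | ⟨⟨-, h⟩, -⟩)
      · exact ((hA u hu).2 y hy huy).1 h
      · exact hnv y hy (((hA u hu).2 y hy huy).2.1 h.symm).symm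
    · exact ((hA u hu).2 y hy huy).2.2
    · intro u hu w hw hu' hw'
      exact (hv1 w hw hw'.1.2).2 u hu hu'.1.2
  · rintro ⟨⟨hAP, hA⟩, hL⟩
    have hLm : ∀ y ∈ A, G.Adj v y → (y ∈ P ∧ G.Adj v y) ∧ y ∉ H := fun y hy h =>
      ⟨⟨(hAP hy).1.2, h⟩, fun hyH => (hAP hy).2 ⟨h, hyH⟩⟩
    refine ⟨fun h => (hAP h).1.1 rfl, ⟨hvP, fun y hy => (hAP hy).1.2⟩, ?_, ?_⟩
    · exact fun y hy hvy => ⟨hv, fun z hz hvz => hL z hz y hy (hLm z hz hvz) (hLm y hy hvy)⟩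
    · refine fun u hu => ⟨fun huv => ⟨(hLm u hu huv.symm).2, fun _ => trivial, fun z hz huz => ?_⟩,
        fun y hy huy => ⟨fun h => (hA u hu y hy huy).1 (.inl h), fun huv => ?_,
          (hA u hu y hy huy).2⟩⟩
      · exact absurd (.inr (hLm u hu huv.symm)) (hA u hu z hz huz).1
      · exact absurd (.inr (hLm u hu huv.symm)) (hA u hu y hy huy).1

/-- This shells the links of vertices outside `H`. The elements of `L` are shed until at most one is
left, when the extra condition is void; the possible exception `q` has no prescribed surroundings
but need never be shed for its own sake. -/
theorem hasShelling_sparseComplexAtMostOne [Fintype V] [DecidableRel G.Adj] (hLP : L ⊆ P)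
    (hLH : L ⊆ H) (hsparse : ∀ P' ⊆ P, HasShelling (sparseComplex G P' H)) (q : V)
    (hq : ∀ v ∈ L, v ≠ q → (∀ y ∈ P, ¬ G.Adj v y) ∨
      ∃ y ∈ P, G.Adj v y ∧ y ∉ L ∧ ∀ z ∈ P, G.Adj y z → z = v) :
    HasShelling (sparseComplexAtMostOne G P H L) := by
  induction hc : L.card generalizing P L with
  | zero =>
    rw [Finset.card_eq_zero] at hc
    subst hc
    convert hsparse P subset_rfl using 1
    ext A
    change A ∈ sparseComplexAtMostOne G P H ∅ ↔ A ∈ sparseComplex G P H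
    simp [mem_sparseComplexAtMostOne]
  | succ n ih =>
    by_cases hn : L.card ≤ 1
    · convert hsparse P subset_rfl using 1
      ext A
      change A ∈ sparseComplexAtMostOne G P H L ↔ A ∈ sparseComplex G P H
      rw [mem_sparseComplexAtMostOne, and_iff_left]
      exact fun u _ v _ hu hv => Finset.card_le_one.1 hn u hu v hv
    -- `y` is the vertex traded for `v`: either a pendant neighbour of `v`, or an isolated vertex of
    -- `L`. A face containing `v` has no other vertex of `L` and no neighbour of `v`, so `y` can
    -- always take its place.
    obtain ⟨v, hvL, y, hyP, hyv, hy, hvy⟩ : ∃ v ∈ L, ∃ y ∈ P, y ≠ v ∧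
        (∀ z ∈ P, G.Adj y z → z = v) ∧ (G.Adj v y ∨ y ∈ L) := by
      by_cases h : ∃ v ∈ L, ∃ y ∈ P, G.Adj v y ∧ y ∉ L ∧ ∀ z ∈ P, G.Adj y z → z = v
      · obtain ⟨v, hv, y, hy, hvy, -, h⟩ := h
        exact ⟨v, hv, y, hy, hvy.ne', h, .inl hvy⟩
      · obtain ⟨t, ht, htq⟩ := Finset.exists_mem_ne (by omega : 1 < L.card) q
        obtain ⟨v, hv, hvt⟩ := Finset.exists_mem_ne (by omega : 1 < L.card) t
        have hiso := (hq t ht htq).resolve_right fun h' => h ⟨t, ht, h'⟩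
        exact ⟨v, hv, t, hLP ht, hvt.symm, fun z hz htz => absurd htz (hiso z hz), .inr ht⟩
    have hvP := hLP hvL
    refine .of_shedding (Δd := sparseComplexAtMostOne G (P.erase v) H (L.erase v))
      (Δl := sparseComplex G ((P.erase v \ G.neighborFinset v) \ L) H) v ?_ ?_ ?_ ?_ ?_
    · intro A
      rw [mem_sparseComplexAtMostOne, mem_sparseComplexAtMostOne, mem_sparseComplex_erase,
        and_assoc]
      refine and_congr_right fun hvA => and_congr_right fun _ => ?_
      have : ∀ u ∈ A, u ∈ L.erase v ↔ u ∈ L := fun u hu => by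
        rw [Finset.mem_erase, and_iff_right]
        exact fun e => hvA (e ▸ hu)
      exact forall₂_congr fun u hu => forall₂_congr fun w hw => by rw [this u hu, this w hw]
    · intro A
      rw [mem_sparseComplexAtMostOne, ← and_assoc, insert_mem_sparseComplex_of_mem hvP (hLH hvL),
        mem_sparseComplex, mem_sparseComplex, Finset.subset_sdiff, and_right_comm]
      refine and_congr_right fun hA => ?_
      have hvA : ∀ u ∈ A, u ≠ v := fun u hu =>
        Finset.ne_of_mem_erase (Finset.mem_sdiff.1 (hA.1 hu)).1
      rw [Finset.disjoint_left]
      constructor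
      · intro h
        simp only [Finset.forall_mem_insert]
        exact ⟨⟨fun _ _ => trivial, fun w hw _ hwL => absurd hwL (h hw)⟩,
          fun u hu => ⟨fun huL => absurd huL (h hu), fun w _ huL => absurd huL (h hu)⟩⟩
      · intro h u hu huL
        exact hvA u hu (h u (Finset.mem_insert_of_mem hu) v (Finset.mem_insert_self v A) huL hvL)
    · intro A hvA hA
      obtain ⟨hA1, hA2⟩ := mem_sparseComplexAtMostOne.1 hA
      have hAL : ∀ u ∈ A, u ∉ L := fun u hu huL => hvA
        (hA2 u (Finset.mem_insert_of_mem hu) v (Finset.mem_insert_self v A) huL hvL ▸ hu)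
      have hyA : y ∉ A := fun hyA => hvy.elim
        (fun h => (hA1.2 v (Finset.mem_insert_self v A) y (Finset.mem_insert_of_mem hyA) h).1
          (hLH hvL)) (hAL y hyA)
      have hA0 := (sparseComplex G P H).lower (Finset.subset_insert v A) hA1
      refine ⟨y, hyA, hyv, insert_mem_sparseComplex_of_not_adj hA0 hyP fun z hz hyz => ?_, ?_⟩
      · exact hvA (hy z (hA0.1 hz) hyz ▸ hz)
      · simp only [Finset.forall_mem_insert]
        exact ⟨⟨fun _ _ => trivial, fun w hw _ hwL => absurd hwL (hAL w hw)⟩,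
          fun u hu => ⟨fun huL => absurd huL (hAL u hu), fun w _ huL => absurd huL (hAL u hu)⟩⟩
    · have hPP := Finset.erase_subset v P
      refine ih (Finset.erase_subset_erase v hLP) ((Finset.erase_subset v L).trans hLH)
        (fun P' hP' => hsparse P' (hP'.trans hPP)) ?_
        (by rw [Finset.card_erase_of_mem hvL]; omega)
      intro u hu huq
      obtain ⟨huv, huL⟩ := Finset.mem_erase.1 hu
      rcases hq u huL huq with h | ⟨w, hw, huw, hwL, h⟩
      · exact .inl fun z hz => h z (hPP hz)
      · exact .inr ⟨w, Finset.mem_erase.2 ⟨fun e => hwL (e ▸ hvL), hw⟩, huw,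
          fun h' => hwL (Finset.mem_of_mem_erase h'), fun z hz => h z (hPP hz)⟩
    · exact hsparse _ (Finset.sdiff_subset.trans
        (Finset.sdiff_subset.trans (Finset.erase_subset v P)))

theorem connectedOn_insert_of_adj {v : V} {K : Finset V} (h : ∀ y ∈ K, G.Adj v y) :
    ConnectedOn G (insert v K) := by
  have key : ∀ y ∈ insert v K, (restrictTo G (insert v K)).Reachable v y := by
    intro y hy
    rcases Finset.mem_insert.1 hy with rfl | hyK
    · exact SimpleGraph.Reachable.refl _
    · exact SimpleGraph.Adj.reachable ⟨h y hyK, Finset.mem_insert_self v K, hy⟩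
  exact fun a ha b hb => (key a ha).symm.trans (key b hb)

/-- An obstruction is an edge at a vertex of `H` or a path on three vertices; connectedness is what
the descent needs. -/
theorem exists_connectedOn_notMem_sparseComplex (hA : A ⊆ P) (h : A ∉ sparseComplex G P H) :
    ∃ K ⊆ A, K ∉ sparseComplex G P H ∧ ConnectedOn G K := by
  have h' : ∃ v ∈ A, ∃ y ∈ A, G.Adj v y ∧ (v ∈ H ∨ ∃ z ∈ A, G.Adj v z ∧ z ≠ y) := by
    by_contra! hcon
    exact h ⟨hA, fun v hv y hy hvy => hcon v hv y hy hvy⟩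
  obtain ⟨v, hv, y, hy, hvy, hvH | ⟨z, hz, hvz, hzy⟩⟩ := h'
  · refine ⟨{v, y}, by simp [Finset.insert_subset_iff, hv, hy], fun hK => ?_,
      connectedOn_insert_of_adj (by simpa using hvy)⟩
    exact (hK.2 v (by simp) y (by simp) hvy).1 hvH
  · refine ⟨{v, y, z}, by simp [Finset.insert_subset_iff, hv, hy, hz], fun hK => ?_,
      connectedOn_insert_of_adj (by simpa using ⟨hvy, hvz⟩)⟩
    exact hzy ((hK.2 v (by simp) y (by simp) hvy).2 z (by simp) hvz)

/-- The vertex `x` from `exists_penultimate` is shed. Since `Y` is a face, each neighbour of `x` in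
`Y` has at most one further neighbour in `P`, and that one is pendant; this is the structure
required of the link. -/
theorem hasShelling_sparseComplex [Fintype V] (hG : G.IsAcyclic) (P H : Finset V) :
    HasShelling (sparseComplex G P H) := by
  classical
  induction hc : P.card using Nat.strong_induction_on generalizing P H with
  | _ c ih =>
  subst hc
  have ih' : ∀ x ∈ P, ∀ P' ⊆ P.erase x, ∀ H, HasShelling (sparseComplex G P' H) :=
    fun x hx P' hP' H => ih P'.card
      ((Finset.card_le_card hP').trans_lt (Finset.card_erase_lt_of_mem hx)) P' H rfl
  by_cases hP : P ∈ sparseComplex G P H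
  · exact .simplex (Q := P) fun A => ⟨fun h => h.1, fun h => (sparseComplex G P H).lower h hP⟩
  have hP' : P ∉ sparseComplex G Finset.univ H := fun h => hP ⟨subset_rfl, h.2⟩
  obtain ⟨x, hx, Y, hYP, hcl, ⟨q, hq⟩, hins, hY⟩ := hG.exists_penultimate
    (fun A hA => exists_connectedOn_notMem_sparseComplex (Finset.subset_univ A) hA)
    ⟨Finset.empty_subset _, by simp⟩ hP'
  have hYP' : Y ⊆ P := hYP.trans (Finset.erase_subset _ _)
  have hxY : x ∉ Y := fun h => Finset.notMem_erase x P (hYP h)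
  have hshed : ∀ A, x ∉ A → insert x A ∈ sparseComplex G P H →
      ∃ y, y ∉ A ∧ y ≠ x ∧ insert y A ∈ sparseComplex G P H := by
    intro A hxA hA
    have hYA : ¬ Y ⊆ A := fun h => hins ⟨Finset.subset_univ _, fun v hv y hy hvy =>
      (hA.2 v (Finset.insert_subset_insert x h hv) y (Finset.insert_subset_insert x h hy)
        hvy).imp_right fun h' z hz => h' z (Finset.insert_subset_insert x h hz)⟩
    obtain ⟨y, hyY, hyA⟩ := Finset.not_subset.1 hYA
    have hA0 := (sparseComplex G P H).lower (Finset.subset_insert x A) hA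
    have hsub : insert y A ⊆ P := Finset.insert_subset (hYP' hyY) hA0.1
    have hsub' : insert y A ⊆ P.erase x :=
      Finset.subset_erase.2 ⟨hsub, by simpa [hxA] using fun e : x = y => hxY (e ▸ hyY)⟩
    refine ⟨y, hyA, fun e => hxY (e ▸ hyY), hsub, fun v hv w hw hvw => ?_⟩
    -- Away from `x` no edge joins `Y` to its complement, so sparseness is checked separately:
    -- inside `Y` because `Y` is a face, outside because `A` is.
    by_cases hvY : v ∈ Y
    · have hnb : ∀ z ∈ insert y A, G.Adj v z → z ∈ Y := fun z hz hvz =>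
        hcl v hvY z (hsub' hz) hvz
      exact (hY.2 v hvY w (hnb w hw hvw) hvw).imp_right fun h z hz hvz => h z (hnb z hz hvz) hvz
    · have hnb : ∀ z ∈ insert y A, G.Adj v z → z ∈ A := fun z hz hvz =>
        (Finset.mem_insert.1 hz).resolve_left fun e =>
          hvY (hcl y hyY v (hsub' hv) (e ▸ hvz.symm))
      have hvA : v ∈ A := (Finset.mem_insert.1 hv).resolve_left fun e => hvY (e ▸ hyY)
      exact (hA0.2 v hvA w (hnb w hw hvw) hvw).imp_right fun h z hz hvz => h z (hnb z hz hvz) hvz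
  by_cases hxH : x ∈ H
  · exact .of_shedding x (fun A => mem_sparseComplex_erase)
      (fun A => (insert_mem_sparseComplex_of_mem hx hxH).symm) hshed
      (ih' x hx _ subset_rfl H) (ih' x hx _ Finset.sdiff_subset H)
  refine .of_shedding x (fun A => mem_sparseComplex_erase)
    (fun A => (insert_mem_sparseComplex_of_notMem hx hxH).symm) hshed
    (ih' x hx _ subset_rfl H) (hasShelling_sparseComplexAtMostOne ?_ Finset.subset_union_right
      (fun P' hP' => ih' x hx P' (hP'.trans Finset.sdiff_subset) _) q ?_)
  · intro y hy
    simp only [Finset.mem_sdiff, Finset.mem_inter, SimpleGraph.mem_neighborFinset,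
      Finset.mem_erase] at hy ⊢
    exact ⟨⟨hy.1.2.ne', hy.1.1⟩, fun h => hy.2 h.2⟩
  · intro v hv hvq
    simp only [Finset.mem_sdiff, Finset.mem_inter, SimpleGraph.mem_neighborFinset] at hv
    obtain ⟨⟨hvP, hxv⟩, hvH⟩ := hv
    have hvY := hq v hvP hxv hvq
    by_cases h : ∃ y ∈ P.erase x \ (G.neighborFinset x ∩ H), G.Adj v y
    · obtain ⟨y, hy, hvy⟩ := h
      have hyY := hcl v hvY y (Finset.mem_sdiff.1 hy).1 hvy
      refine .inr ⟨y, hy, hvy, fun hyL => ?_, fun z hz hyz => ?_⟩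
      · simp only [Finset.mem_sdiff, Finset.mem_inter, SimpleGraph.mem_neighborFinset] at hyL
        -- Otherwise `x`, `v`, `y` would form a triangle.
        exact hvy.ne (hG.eq_of_adj_of_reachable hxY hxv hyL.1.2
          (SimpleGraph.Adj.reachable ⟨hvy, hvY, hyY⟩))
      · exact (hY.2 y hyY v hvY hvy.symm).2 z (hcl y hyY z (Finset.mem_sdiff.1 hz).1 hyz) hyz
    · exact .inl fun y hy hvy => h ⟨y, hy, hvy⟩

end Sparse

/-! ### The r-independence complexes. -/

section RIndependence

variable {V : Type*} [DecidableEq V] {G : SimpleGraph V} {r : ℕ} {x : V}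

/-- The link of the vertex `v`. -/
def linkComplex (Δ : LowerSet (Finset V)) (v : V) : LowerSet (Finset V) where
  carrier := {A | v ∉ A ∧ insert v A ∈ Δ}
  lower' := fun _ _ hBA hA =>
    ⟨fun h => hA.1 (hBA h), Δ.lower (Finset.insert_subset_insert v hBA) hA.2⟩

theorem mem_linkComplex {Δ : LowerSet (Finset V)} {v : V} {A : Finset V} :
    A ∈ linkComplex Δ v ↔ v ∉ A ∧ insert v A ∈ Δ := Iff.rfl

variable [Fintype V]

omit [DecidableEq V] in
theorem mem_rIndependenceComplex {A : Finset V} : A ∈ rIndependenceComplex G r ↔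
    ∀ K ⊆ A, ConnectedOn G K → K.card ≤ r := isRIndependent_iff

-- A large connected set meeting the component of `x` is contained in it, so only that component has
-- to be measured.
omit [DecidableEq V] in
theorem mem_rIndependenceComplex_iff_reachSet {Q : Finset V} (hx : x ∈ Q)
    (h : ∀ K ⊆ Q, ConnectedOn G K → r < K.card → ∃ y ∈ K, y ∈ reachSet G Q x) :
    Q ∈ rIndependenceComplex G r ↔ (reachSet G Q x).card ≤ r := by
  rw [mem_rIndependenceComplex]
  refine ⟨fun h' => h' _ (reachSet_subset hx) connectedOn_reachSet, fun h' K hKQ hK => ?_⟩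
  by_contra! hr
  obtain ⟨y, hyK, hy⟩ := h K hKQ hK hr
  refine absurd ((Finset.card_le_card fun u hu => ?_).trans h') hr.not_ge
  exact mem_reachSet.2 ((mem_reachSet.1 hy).trans
    (mem_reachSet.1 (hK.subset_reachSet hKQ hyK hu)))

omit [DecidableEq V] [Fintype V] in
theorem ConnectedOn.exists_adj {K : Finset V} (hK : ConnectedOn G K) (hx : x ∈ K)
    (hc : 1 < K.card) : ∃ y ∈ K, G.Adj x y := by
  by_contra! h
  obtain ⟨y, hy, hyx⟩ := Finset.exists_mem_ne hc x
  exact hyx (hK.subset_of_closed hx (S := (· = x)) rfl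
    (fun b _ c hc hb hbc => absurd (hb ▸ hbc) (h c hc)) y hy)

theorem rIndependenceComplex_one :
    rIndependenceComplex G 1 = sparseComplex G Finset.univ Finset.univ := by
  ext A
  change A ∈ rIndependenceComplex G 1 ↔ A ∈ sparseComplex G _ _
  rw [mem_rIndependenceComplex, mem_sparseComplex]
  constructor
  · refine fun h => ⟨Finset.subset_univ A, fun v hv y hy hvy => ?_⟩
    have := h {v, y} (by simp [Finset.insert_subset_iff, hv, hy])
      (connectedOn_insert_of_adj (by simpa using hvy))
    rw [Finset.card_pair hvy.ne] at this
    omega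
  · rintro ⟨-, h⟩ K hKA hK
    by_contra! hc
    obtain ⟨v, hv⟩ : K.Nonempty := Finset.card_pos.1 (by omega)
    obtain ⟨y, hy, hvy⟩ := hK.exists_adj hv hc
    exact (h v (hKA hv) y (hKA hy) hvy).1 (Finset.mem_univ v)

theorem rIndependenceComplex_two :
    rIndependenceComplex G 2 = sparseComplex G Finset.univ ∅ := by
  ext A
  change A ∈ rIndependenceComplex G 2 ↔ A ∈ sparseComplex G _ _
  rw [mem_rIndependenceComplex, mem_sparseComplex]
  constructor
  · refine fun h => ⟨Finset.subset_univ A, fun v hv y hy hvy =>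
      ⟨Finset.notMem_empty v, fun z hz hvz => ?_⟩⟩
    by_contra hzy
    have := h {v, y, z} (by simp [Finset.insert_subset_iff, hv, hy, hz])
      (connectedOn_insert_of_adj (by simpa using ⟨hvy, hvz⟩))
    rw [Finset.card_eq_three.2 ⟨v, y, z, hvy.ne, hvz.ne, Ne.symm hzy, rfl⟩] at this
    omega
  · rintro ⟨-, h⟩ K hKA hK
    by_contra! hc
    obtain ⟨v, hv⟩ : K.Nonempty := Finset.card_pos.1 (by omega)
    obtain ⟨y, hy, hvy⟩ := hK.exists_adj hv (by omega)
    have hsub : K ⊆ {v, y} := fun u hu => by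
      refine hK.subset_of_closed hv (S := (· ∈ ({v, y} : Finset V))) (by simp) ?_ u hu
      intro b hb c hc hbS hbc
      rcases Finset.mem_insert.1 hbS with rfl | hbS
      · simp [(h b (hKA hv) y (hKA hy) hvy).2 c (hKA hc) hbc]
      · rw [Finset.mem_singleton] at hbS
        subst hbS
        simp [(h b (hKA hy) v (hKA hv) hvy.symm).2 c (hKA hc) hbc]
    have := (Finset.card_le_card hsub).trans Finset.card_le_two
    omega

/-- If all large connected sets share a vertex, then the complex is shellable. -/
theorem hasShelling_rIndependenceComplex_of_common_vertex (hG : G.IsAcyclic)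
    (hx : ∀ K, ConnectedOn G K → r < K.card → x ∈ K) :
    HasShelling (rIndependenceComplex G r) := by
  by_cases huniv : Finset.univ ∈ rIndependenceComplex G r
  · exact .simplex (Q := Finset.univ) fun A => ⟨fun _ => Finset.subset_univ A,
      fun h => (rIndependenceComplex G r).lower h huniv⟩
  have hdel : ∀ A, x ∉ A → A ∈ rIndependenceComplex G r := fun A hA =>
    mem_rIndependenceComplex.2 fun K hKA hK => not_lt.1 fun hc => hA (hKA (hx K hK hc))
  refine .of_shedding (Δd := avoidingComplex (Finset.univ.erase x) ∅)
    (Δl := linkComplex (rIndependenceComplex G r) x) x ?_ (fun A => Iff.rfl) ?_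
    (.simplex (Q := Finset.univ.erase x) fun A => by simp [mem_avoidingComplex])
    (hasShelling_of_reachSet_card_le hG (Finset.mem_singleton_self x) r ?_)
  · intro A
    simp only [mem_avoidingComplex, Finset.subset_erase, Finset.subset_univ, true_and,
      Set.mem_empty_iff_false, false_imp_iff, implies_true, and_true]
    exact ⟨fun h => ⟨h, hdel A h⟩, fun h => h.1⟩
  · intro A hxA hA
    have : ∃ y, y ∉ insert x A := by
      by_contra! h
      exact huniv (Finset.eq_univ_iff_forall.2 h ▸ hA)
    obtain ⟨y, hy⟩ := this
    rw [Finset.mem_insert, not_or] at hy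
    exact ⟨y, hy.2, hy.1, hdel _ (by simp [hxA, Ne.symm hy.1])⟩
  · intro A
    rw [mem_linkComplex, Finset.disjoint_singleton_right, Finset.union_singleton]
    exact and_congr_right fun _ => mem_rIndependenceComplex_iff_reachSet
      (Finset.mem_insert_self x A) fun K _ hK hc => ⟨x, hx K hK hc, self_mem_reachSet⟩

/-- In a forest, pairwise intersecting large connected sets have a common vertex. -/
theorem SimpleGraph.IsAcyclic.exists_common_vertex [Nonempty V] (hG : G.IsAcyclic)
    (h : ∀ K K', ConnectedOn G K → ConnectedOn G K' → r < K.card → r < K'.card →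
      ¬ Disjoint K K') :
    ∃ x, ∀ K, ConnectedOn G K → r < K.card → x ∈ K := by
  have hconn : ∀ A, A ∉ rIndependenceComplex G r → ∃ K ⊆ A, K ∉ rIndependenceComplex G r ∧
      ConnectedOn G K := by
    intro A hA
    rw [mem_rIndependenceComplex] at hA
    push Not at hA
    obtain ⟨K, hKA, hK, hc⟩ := hA
    exact ⟨K, hKA, fun h => (mem_rIndependenceComplex.1 h K subset_rfl hK).not_gt hc, hK⟩
  have hempty : ∅ ∈ rIndependenceComplex G r := by
    rw [mem_rIndependenceComplex]
    intro K hK _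
    simp [Finset.subset_empty.1 hK]
  by_cases huniv : Finset.univ ∈ rIndependenceComplex G r
  · exact ⟨Classical.arbitrary V, fun K hK hc => absurd
      (mem_rIndependenceComplex.1 huniv K (Finset.subset_univ K) hK) hc.not_ge⟩
  -- A large connected set `K` avoiding `x` but meeting `Y` stays inside `Y`, which is a face; so
  -- `K` would be disjoint from the large connected set inside `insert x Y`.
  obtain ⟨x, -, Y, hYx, hcl, -, hins, hY⟩ := hG.exists_penultimate hconn hempty huniv
  refine ⟨x, fun K hK hc => ?_⟩
  by_contra hxK
  rw [mem_rIndependenceComplex] at hins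
  push Not at hins
  obtain ⟨K', hK'Y, hK', hc'⟩ := hins
  refine h K K' hK hK' hc hc' (Finset.disjoint_left.2 fun u hu hu' => ?_)
  have huY : u ∈ Y := (Finset.mem_insert.1 (hK'Y hu')).resolve_left fun e => hxK (e ▸ hu)
  have hKY : K ⊆ Y := hK.subset_of_closed hu (S := (· ∈ Y)) huY fun b _ c hc hb hbc =>
    hcl b hb c (Finset.mem_erase.2 ⟨fun e => hxK (e ▸ hc), Finset.mem_univ c⟩) hbc
  exact (mem_rIndependenceComplex.1 hY K hKY hK).not_gt hc

/-- If the vertex set splits into two connected sets of size `r + 1`, then the complex is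
shellable. -/
theorem hasShelling_rIndependenceComplex_of_partition (hG : G.IsAcyclic) {A B : Finset V}
    (hA : ConnectedOn G A) (hB : ConnectedOn G B) (hAB : Disjoint A B)
    (huniv : A ∪ B = Finset.univ) (hAc : A.card = r + 1) (hBc : B.card = r + 1) :
    HasShelling (rIndependenceComplex G r) := by
  have hmem : ∀ u, u ∉ A → u ∈ B := fun u hu =>
    (Finset.mem_union.1 (huniv ▸ Finset.mem_univ u)).resolve_left hu
  have hdis : ∀ u, u ∈ A → u ∉ B := fun u hu => Finset.disjoint_left.1 hAB hu
  have hnot : ∀ {T K : Finset V}, T ∈ rIndependenceComplex G r → ConnectedOn G K →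
      K.card = r + 1 → ¬ K ⊆ T := fun hT hK hKc hKT => by
    have := mem_rIndependenceComplex.1 hT _ hKT hK
    omega
  -- A large connected set is `A`, or `B`, or crosses from `A` to `B`.
  have hbig : ∀ K, ConnectedOn G K → r < K.card →
      K = A ∨ K = B ∨ ∃ a ∈ K, ∃ b ∈ K, a ∈ A ∧ b ∈ B ∧ G.Adj a b := by
    intro K hK hc
    by_cases hcr : ∃ a ∈ K, ∃ b ∈ K, a ∈ A ∧ b ∈ B ∧ G.Adj a b
    · exact .inr (.inr hcr)
    obtain ⟨u, hu⟩ : K.Nonempty := Finset.card_pos.1 (by omega)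
    by_cases huA : u ∈ A
    · refine .inl (Finset.eq_of_subset_of_card_le ?_ (by omega))
      exact hK.subset_of_closed hu (S := (· ∈ A)) huA fun b hb c hc hbA hbc =>
        by_contra fun hcA => hcr ⟨b, hb, c, hc, hbA, hmem c hcA, hbc⟩
    · refine .inr (.inl (Finset.eq_of_subset_of_card_le ?_ (by omega)))
      exact hK.subset_of_closed hu (S := (· ∈ B)) (hmem u huA) fun b hb c hc hbB hbc =>
        by_contra fun hcB => hcr ⟨c, hc, b, hb, by_contra fun h => hcB (hmem c h), hbB, hbc.symm⟩
  by_cases hedge : ∃ a ∈ A, ∃ b ∈ B, G.Adj a b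
  swap
  · convert hasShelling_avoidingComplex_pair (Finset.subset_univ A) (Finset.subset_univ B) hAB
      using 1
    ext T
    change T ∈ rIndependenceComplex G r ↔ T ∈ avoidingComplex _ _
    simp only [mem_avoidingComplex, Set.mem_singleton_iff, forall_eq, Set.mem_insert_iff,
      forall_eq_or_imp, Finset.subset_univ, true_and]
    refine ⟨fun hT => ⟨hnot hT hA hAc, hnot hT hB hBc⟩, fun hT =>
      mem_rIndependenceComplex.2 fun K hKT hK => ?_⟩
    by_contra! hc
    rcases hbig K hK hc with rfl | rfl | ⟨a, -, b, -, ha, hb, hab⟩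
    exacts [hT.1 hKT, hT.2 hKT, hedge ⟨a, ha, b, hb, hab⟩]
  obtain ⟨a, ha, b, hb, hab⟩ := hedge
  -- Only one edge joins `A` to `B`, so every crossing set contains both of its ends.
  have hbig' : ∀ K, ConnectedOn G K → r < K.card → K = A ∨ K = B ∨ (a ∈ K ∧ b ∈ K) := by
    intro K hK hc
    refine (hbig K hK hc).imp_right (Or.imp_right ?_)
    rintro ⟨a', haK, b', hbK, ha', hb', hab'⟩
    obtain ⟨rfl, rfl⟩ := hG.eq_of_adj_of_connectedOn hA hB hAB ha hb hab ha' hb' hab'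
    exact ⟨haK, hbK⟩
  have hface : ∀ T, (a ∉ T ∨ b ∉ T) → (T ∈ rIndependenceComplex G r ↔ ¬ A ⊆ T ∧ ¬ B ⊆ T) := by
    intro T hT
    refine ⟨fun hT => ⟨hnot hT hA hAc, hnot hT hB hBc⟩, fun hT' =>
      mem_rIndependenceComplex.2 fun K hKT hK => ?_⟩
    by_contra! hc
    rcases hbig' K hK hc with rfl | rfl | ⟨haK, hbK⟩
    · exact hT'.1 hKT
    · exact hT'.2 hKT
    · exact hT.elim (fun h => h (hKT haK)) fun h => h (hKT hbK)
  have hab' : a ≠ b := hab.ne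
  have hbA : b ∉ A := fun h => hdis b h hb
  -- Without `a` neither `A` nor a crossing set fits, so only `B` must be avoided; in the link of
  -- `a`, the vertex `b` is shed likewise.
  refine .of_shedding (Δd := avoidingComplex (Finset.univ.erase a) {B})
    (Δl := linkComplex (rIndependenceComplex G r) a) a ?_ (fun T => Iff.rfl) ?_
    (hasShelling_avoidingComplex_singleton
      (Finset.subset_erase.2 ⟨Finset.subset_univ B, hdis a ha⟩)) ?_
  · intro T
    simp only [mem_avoidingComplex, Finset.subset_erase, Finset.subset_univ, true_and,
      Set.mem_singleton_iff, forall_eq]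
    refine and_congr_right fun haT => ?_
    rw [hface T (.inl haT), and_iff_right fun h => haT (h ha)]
  · intro T haT hT
    obtain ⟨y, hyA, hy⟩ := Finset.not_subset.1 (hnot hT hA hAc)
    rw [Finset.mem_insert, not_or] at hy
    have hay : a ∉ insert y T := by simp [haT, Ne.symm hy.1]
    refine ⟨y, hy.2, hy.1, (hface _ (.inl hay)).2 ⟨fun h => hay (h ha), fun h => ?_⟩⟩
    rw [Finset.subset_insert_iff_of_notMem (hdis y hyA)] at h
    exact hnot hT hB hBc (h.trans (Finset.subset_insert a T))
  refine .of_shedding (Δd := avoidingComplex ((Finset.univ.erase a).erase b) {A.erase a})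
    (Δl := linkComplex (linkComplex (rIndependenceComplex G r) a) b) b ?_ (fun T => Iff.rfl) ?_
    (hasShelling_avoidingComplex_singleton (Finset.subset_erase.2
      ⟨Finset.erase_subset_erase a (Finset.subset_univ A),
        fun h => hbA (Finset.mem_of_mem_erase h)⟩))
    -- With `a` and `b` both present, every large connected set meets the component of `a`.
    (hasShelling_of_reachSet_card_le hG (x := a) (R := {a, b}) (by simp) r ?_)
  · intro T
    simp only [mem_avoidingComplex, Finset.subset_erase, Finset.subset_univ, true_and,
      Set.mem_singleton_iff, forall_eq, mem_linkComplex]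
    rw [and_comm (a := a ∉ T), and_assoc]
    refine and_congr_right fun hbT => and_congr_right fun haT => ?_
    have hbaT : b ∉ insert a T := by simp [hbT, hab'.symm]
    rw [hface _ (.inr hbaT), and_iff_left fun h => hbaT (h hb), Finset.subset_insert_iff]
  · intro T hbT hT
    obtain ⟨haT, hT⟩ := mem_linkComplex.1 hT
    obtain ⟨y, hyB, hy⟩ := Finset.not_subset.1 (hnot hT hB hBc)
    simp only [Finset.mem_insert, not_or] at hy haT
    have hbay : b ∉ insert a (insert y T) := by simp [hbT, hab'.symm, Ne.symm hy.2.1]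
    have hyA : y ∉ A := fun h => hdis y h hyB
    refine ⟨y, hy.2.2, hy.2.1, mem_linkComplex.2 ⟨by simp [haT.2, Ne.symm hy.1], ?_⟩⟩
    refine (hface _ (.inr hbay)).2 ⟨fun h => ?_, fun h => hbay (h hb)⟩
    rw [Finset.insert_comm, Finset.subset_insert_iff_of_notMem hyA] at h
    refine hnot hT hA hAc (h.trans ?_)
    exact Finset.insert_subset_insert a (Finset.subset_insert b T)
  · intro T
    have hT : T ∪ {a, b} = insert a (insert b T) := by
      ext y; simp only [Finset.mem_union, Finset.mem_insert, Finset.mem_singleton]; tauto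
    have haQ : a ∈ insert a (insert b T) := by simp
    rw [mem_linkComplex, mem_linkComplex, hT, ← and_assoc]
    refine and_congr ?_ (mem_rIndependenceComplex_iff_reachSet haQ ?_)
    · simp [Finset.disjoint_insert_right, hab', and_comm]
    · intro K _ hK hc
      rcases hbig' K hK hc with rfl | rfl | ⟨haK, -⟩
      · exact ⟨a, ha, self_mem_reachSet⟩
      · exact ⟨b, hb, mem_reachSet_of_adj self_mem_reachSet hab haQ (by simp)⟩
      · exact ⟨a, haK, self_mem_reachSet⟩

end RIndependence

/-! ### Assembly of the cases. -/

theorem theorem4p6 {V : Type*} [Fintype V] (G : SimpleGraph V) (hG : G.IsAcyclic) (r : ℕ)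
    (hr : 1 ≤ r) (hn : (Fintype.card V : ℤ) - 5 ≤ (r : ℤ)) :
    IsShellable (rIndependenceComplex G r) := by
  rcases isEmpty_or_nonempty V with hV | hV
  · exact (HasShelling.of_subsingleton fun E F _ _ => Subsingleton.elim E F).isShellable
  classical
  apply HasShelling.isShellable
  rcases (by omega : r = 1 ∨ r = 2 ∨ 3 ≤ r) with rfl | rfl | hr3
  · rw [rIndependenceComplex_one]
    exact hasShelling_sparseComplex hG _ _
  · rw [rIndependenceComplex_two]
    exact hasShelling_sparseComplex hG _ _
  by_cases h : ∃ A B, ConnectedOn G A ∧ ConnectedOn G B ∧ r < A.card ∧ r < B.card ∧ Disjoint A B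
  · obtain ⟨A, B, hA, hB, hAc, hBc, hAB⟩ := h
    have h1 := Finset.card_union_of_disjoint hAB
    have h2 := Finset.card_le_univ (A ∪ B)
    -- From 2r + 2 ≤ |A| + |B| ≤ n ≤ r + 5 and r ≥ 3, equality holds throughout.
    exact hasShelling_rIndependenceComplex_of_partition hG hA hB hAB
      ((Finset.card_eq_iff_eq_univ _).1 (by omega)) (by omega) (by omega)
  obtain ⟨x, hx⟩ := hG.exists_common_vertex (r := r) fun K K' hK hK' hc hc' hd =>
    h ⟨K, K', hK, hK', hc, hc', hd⟩
  exact hasShelling_rIndependenceComplex_of_common_vertex hG hx
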